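/- Let $G$ be a complex Lie group (modelled on a complex Banach space, for instance finite-dimensional), and let $BG$ be the simplicial complex manifold with $G^s$ in degree $s\ge 0$ and face maps $d_0,\dots,d_{s+1}\colon G^{s+1}\to G^s$, $$d_0(g_1,\dots,g_{s+1})=(g_2,\dots,g_{s+1}),\qquad d_j(g_1,\dots,g_{s+1})=(g_1,\dots,g_jg_{j+1},\dots,g_{s+1})\ (1\le j\le s),\qquad d_{s+1}(g_1,\dots,g_{s+1})=(g_1,\dots,g_s).$$ Write $\Omega^r_{loc}(G^s)=\varinjlim_{(1,\dots,1)\in U\subseteq G^s}\Omega^r(U)$ for the group of germs at $(1,\dots,1)$ of holomorphic $r$-forms on $G^s$. It carries the exterior derivative $d\colon\Omega^r_{loc}(G^s)\to\Omega^{r+1}_{loc}(G^s)$ and the simplicial differential $\delta=\sum_{j=0}^{s+1}(-1)^jd_j^*\colon\Omega^r_{loc}(G^s)\to\Omega^r_{loc}(G^{s+1})$. For an integer $p\ge 1$ put $\mathbb Z(p)=(2\pi i)^p\mathbb Z\subset\mathbb C$. The local Deligne cohomology $H^n_{loc}(BG,\mathbb Z(p)_D)$ is the degree-$n$ cohomology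 of the total complex of the double complex whose component in bidegree $(q,s)$, $q,s\ge0$, is $$\mathbb Z(p)\ \text{ if } q=0,\qquad \Omega^{q-1}_{loc}(G^s)\ \text{ if } 1\le q\le p,\qquad 0\ \text{ if } q\ge p+1,$$ with differentials $\mathbb Z(p)\hookrightarrow\Omega^0_{loc}(G^s)\xrightarrow{d}\cdots\xrightarrow{d}\Omega^{p-1}_{loc}(G^s)$ in the $q$-direction and $\sum_j(-1)^jd_j^*$ in the $s$-direction. The local truncated de Rham double complex $F^p\Omega^\bullet_{loc}(BG)$ has in bidegree $(r,s)$ the component $\Omega^r_{loc}(G^s)$ if $r\ge p$, and $0$ otherwise, with differentials $d$ and $\delta$. (The total differential of a double complex is $\delta+(-1)^sd$ on the component of bidegree $(\cdot,s)$.) Proposition 4.1. For every $p\ge1$, the group $H^{2p}_{loc}(BG,\mathbb Z(p)_D)$ is isomorphic to the degree-$2p$ cohomology of the total complex of $F^p\Omega^\bullet_{loc}(BG)$. More precisely, the morphism of double complexes that is $d\colon\Omega^{p-1}_{loc}(G^s)\to\Omega^p_{loc}(G^s)$ in the bidegrees $(p,s)$ and $0$ in all other bidegrees induces an isomorphism between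 the two groups. -/

import Mathlib

open Filter Topology
open scoped Manifold ContDiff

namespace LocalDeligne

section Germs

variable {V W U : Type*} [NormedAddCommGroup V] [NormedSpace ℂ V]
  [NormedAddCommGroup W] [NormedSpace ℂ W] [NormedAddCommGroup U] [NormedSpace ℂ U]

/-- Alternatization of multilinear forms as a continuous linear map; only used to prove that pull-backs
of analytic forms are analytic. -/
noncomputable def alternatizationCLM (V : Type*) [NormedAddCommGroup V] [NormedSpace ℂ V] (r : ℕ) :
    ContinuousMultilinearMap ℂ (fun _ : Fin r => V) ℂ →L[ℂ] (V [⋀^Fin r]→L[ℂ] ℂ) :=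
  LinearMap.mkContinuous
    { toFun := fun f => ContinuousMultilinearMap.alternatization f
      map_add' := fun f g => map_add _ f g
      map_smul' := fun c f => by
        ext v
        simp [ContinuousMultilinearMap.alternatization_apply_apply, Finset.mul_sum,
          Units.smul_def, mul_left_comm] }
    (r.factorial : ℝ) (fun f => by
      refine ContinuousAlternatingMap.opNorm_le_bound _ (by positivity) fun v => ?_
      have h : ∀ σ : Equiv.Perm (Fin r),
          ‖(Equiv.Perm.sign σ) • f (v ∘ σ)‖ ≤ ‖f‖ * ∏ i, ‖v i‖ := fun σ => by
        have h1 : ‖(Equiv.Perm.sign σ) • f (v ∘ σ)‖ = ‖f (v ∘ σ)‖ := by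
          rcases Int.units_eq_one_or (Equiv.Perm.sign σ) with h | h <;> simp [h]
        rw [h1]
        refine (f.le_opNorm _).trans_eq ?_
        congr 1
        exact Equiv.prod_comp σ (fun i => ‖v i‖)
      calc _ = ‖∑ σ : Equiv.Perm (Fin r), (Equiv.Perm.sign σ) • f (v ∘ σ)‖ := by
            simp [ContinuousMultilinearMap.alternatization_apply_apply]
        _ ≤ ∑ σ : Equiv.Perm (Fin r), ‖f‖ * ∏ i, ‖v i‖ :=
            norm_sum_le_of_le _ fun σ _ => h σ
        _ = _ := by simp [Fintype.card_perm, mul_assoc])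

theorem alternatizationCLM_coe (r : ℕ) (f : V [⋀^Fin r]→L[ℂ] ℂ) :
    alternatizationCLM V r f.toContinuousMultilinearMap = (r.factorial : ℂ) • f := by
  ext v
  have : ∀ σ : Equiv.Perm (Fin r), (Equiv.Perm.sign σ) • f (v ∘ σ) = f v := fun σ => by
    have := f.toAlternatingMap.map_perm v σ
    simp only [ContinuousAlternatingMap.coe_toAlternatingMap] at this
    rw [this, smul_smul]
    simp
  simp [alternatizationCLM, ContinuousMultilinearMap.alternatization_apply_apply, this,
    Fintype.card_perm]

theorem analyticAt_comp_linear {r : ℕ} {x : U} {f : U → V [⋀^Fin r]→L[ℂ] ℂ} {L : U → W →L[ℂ] V}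
    (hf : AnalyticAt ℂ f x) (hL : AnalyticAt ℂ L x) :
    AnalyticAt ℂ (fun z => (f z).compContinuousLinearMap (L z)) x := by
  have key : (fun z => (f z).compContinuousLinearMap (L z)) = fun z =>
      ((r.factorial : ℂ)⁻¹) • alternatizationCLM W r
        ((ContinuousMultilinearMap.compContinuousLinearMapContinuousMultilinear ℂ
          (fun _ : Fin r => W) (fun _ : Fin r => V) ℂ (fun _ => L z))
          (ContinuousAlternatingMap.toContinuousMultilinearMapCLM ℂ (f z))) := by
    funext z
    have : (ContinuousMultilinearMap.compContinuousLinearMapContinuousMultilinear ℂ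
          (fun _ : Fin r => W) (fun _ : Fin r => V) ℂ (fun _ => L z))
          (ContinuousAlternatingMap.toContinuousMultilinearMapCLM ℂ (f z)) =
        ((f z).compContinuousLinearMap (L z)).toContinuousMultilinearMap := rfl
    rw [this, alternatizationCLM_coe, smul_smul, inv_mul_cancel₀, one_smul]
    exact_mod_cast r.factorial_ne_zero
  rw [key]
  have h1 : AnalyticAt ℂ (fun z => (ContinuousMultilinearMap.compContinuousLinearMapContinuousMultilinear ℂ
          (fun _ : Fin r => W) (fun _ : Fin r => V) ℂ (fun _ => L z))) x :=
    (ContinuousMultilinearMap.analyticAt _).comp (g := fun m => _) (f := fun z => fun _ : Fin r => L z)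
      (AnalyticAt.pi fun _ => hL)
  have h2 : AnalyticAt ℂ (fun z => ContinuousAlternatingMap.toContinuousMultilinearMapCLM ℂ (f z)) x :=
    (ContinuousLinearMap.analyticAt _ _).comp hf
  have h3 := (h1.contDiffAt (n := ω).clm_apply (h2.contDiffAt (n := ω))).analyticAt
  have h4 := (ContinuousLinearMap.analyticAt (alternatizationCLM W r) _).comp h3
  exact (analyticAt_const (v := ((r.factorial : ℂ)⁻¹))).smul h4


/-- Germs at `x` of holomorphic `r`-forms on the complex normed space `V`: germs at `x` of maps `η`
from `V` to the continuous alternating `r`-linear forms on `V` that are complex analytic near `x`. -/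
def HolGerm (x : V) (r : ℕ) : AddSubgroup ((𝓝 x).Germ (V [⋀^Fin r]→L[ℂ] ℂ)) where
  carrier := {γ | ∃ η : V → V [⋀^Fin r]→L[ℂ] ℂ, AnalyticAt ℂ η x ∧ (η : (𝓝 x).Germ _) = γ}
  zero_mem' := ⟨0, analyticAt_const, rfl⟩
  add_mem' := by
    rintro _ _ ⟨η, hη, rfl⟩ ⟨θ, hθ, rfl⟩
    exact ⟨η + θ, hη.add hθ, rfl⟩
  neg_mem' := by
    rintro _ ⟨η, hη, rfl⟩
    exact ⟨-η, hη.neg, rfl⟩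

/-- The germ at `x` of a form that is holomorphic near `x`. -/
def HolGerm.mk {x : V} {r : ℕ} (η : V → V [⋀^Fin r]→L[ℂ] ℂ) (h : AnalyticAt ℂ η x) :
    HolGerm x r := ⟨(η : (𝓝 x).Germ _), η, h, rfl⟩

theorem HolGerm.induction {x : V} {r : ℕ} {P : HolGerm x r → Prop}
    (h : ∀ η hη, P (HolGerm.mk η hη)) (γ : HolGerm x r) : P γ := by
  obtain ⟨_, η, hη, rfl⟩ := γ
  exact h η hη

theorem HolGerm.mk_eq {x : V} {r : ℕ} {η θ : V → V [⋀^Fin r]→L[ℂ] ℂ} {hη : AnalyticAt ℂ η x}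
    {hθ : AnalyticAt ℂ θ x} : HolGerm.mk η hη = HolGerm.mk θ hθ ↔ η =ᶠ[𝓝 x] θ := by
  rw [Subtype.ext_iff]
  exact Germ.coe_eq

theorem analyticAt_extDeriv {x : V} {r : ℕ} {η : V → V [⋀^Fin r]→L[ℂ] ℂ}
    (h : AnalyticAt ℂ η x) : AnalyticAt ℂ (extDeriv η) x := by
  have : extDeriv η = ContinuousAlternatingMap.alternatizeUncurryFinCLM ℂ V ℂ ∘ fderiv ℂ η := by
    funext z
    simp [extDeriv]
  rw [this]
  exact (ContinuousLinearMap.analyticAt _ _).comp h.fderiv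

/-- The exterior derivative on germs of holomorphic forms. -/
noncomputable def dGerm (x : V) (r : ℕ) : HolGerm x r →+ HolGerm x (r + 1) where
  toFun γ := ⟨Germ.map' extDeriv (fun _ _ h => h.extDeriv) γ.1, by
    obtain ⟨_, η, hη, rfl⟩ := γ
    exact ⟨extDeriv η, analyticAt_extDeriv hη, rfl⟩⟩
  map_zero' := by
    rw [Subtype.ext_iff]
    refine Germ.coe_eq.2 (Eventually.of_forall fun y => ?_)
    ext v
    have : fderiv ℂ (fun _ => 0 : V → V [⋀^Fin r]→L[ℂ] ℂ) y = 0 := by simp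
    simp only [extDeriv, this]
    simp [ContinuousAlternatingMap.alternatizeUncurryFin_apply]
  map_add' := by
    rintro ⟨_, η, hη, rfl⟩ ⟨_, θ, hθ, rfl⟩
    rw [Subtype.ext_iff]
    refine Germ.coe_eq.2 ?_
    filter_upwards [hη.eventually_analyticAt, hθ.eventually_analyticAt] with y h1 h2
    exact extDeriv_add h1.differentiableAt h2.differentiableAt

theorem dGerm_mk {x : V} {r : ℕ} (η : V → V [⋀^Fin r]→L[ℂ] ℂ) (hη : AnalyticAt ℂ η x) :
    dGerm x r (HolGerm.mk η hη) = HolGerm.mk (extDeriv η) (analyticAt_extDeriv hη) := rfl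

theorem analyticAt_pullback [CompleteSpace W] {F : V → W} {x : V} {r : ℕ} (hF : AnalyticAt ℂ F x)
    {η : W → W [⋀^Fin r]→L[ℂ] ℂ} (hη : AnalyticAt ℂ η (F x)) :
    AnalyticAt ℂ (fun z => (η (F z)).compContinuousLinearMap (fderiv ℂ F z)) x :=
  analyticAt_comp_linear (hη.comp hF) hF.fderiv

/-- Pull-back of germs of holomorphic forms along (the germ at `x` of) a holomorphic map `F` with
`F x = y`: `(F^* η)_z (v₁, …, v_r) = η_{F z} (dF_z v₁, …, dF_z v_r)`. -/
noncomputable def pullGerm [CompleteSpace W] (F : V → W) {x : V} {y : W} (hF : AnalyticAt ℂ F x) (hxy : F x = y)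
    (r : ℕ) : HolGerm y r →+ HolGerm x r where
  toFun γ := ⟨Germ.map'
      (fun η z => (η (F z)).compContinuousLinearMap (fderiv ℂ F z))
      (fun η θ h => by
        have ht : Tendsto F (𝓝 x) (𝓝 y) := hxy ▸ hF.continuousAt
        filter_upwards [ht.eventually h] with z hz
        rw [hz]) γ.1, by
    subst hxy
    obtain ⟨_, η, hη, rfl⟩ := γ
    exact ⟨_, analyticAt_pullback hF hη, rfl⟩⟩
  map_zero' := by
    rw [Subtype.ext_iff]
    exact Germ.coe_eq.2 (Eventually.of_forall fun z => rfl)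
  map_add' := by
    rintro ⟨_, η, hη, rfl⟩ ⟨_, θ, hθ, rfl⟩
    rw [Subtype.ext_iff]
    exact Germ.coe_eq.2 (Eventually.of_forall fun z => rfl)

theorem pullGerm_mk [CompleteSpace W] (F : V → W) {x : V} (hF : AnalyticAt ℂ F x) {r : ℕ}
    (η : W → W [⋀^Fin r]→L[ℂ] ℂ) (hη : AnalyticAt ℂ η (F x)) :
    pullGerm F hF rfl r (HolGerm.mk η hη) =
      HolGerm.mk (fun z => (η (F z)).compContinuousLinearMap (fderiv ℂ F z))
        (analyticAt_pullback hF hη) := rfl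

theorem dGerm_dGerm {x : V} {r : ℕ} (γ : HolGerm x r) : dGerm x (r + 1) (dGerm x r γ) = 0 := by
  induction γ using HolGerm.induction with
  | h η hη =>
    rw [dGerm_mk, dGerm_mk]
    refine HolGerm.mk_eq (hθ := analyticAt_const) |>.2 ?_
    filter_upwards [hη.eventually_analyticAt] with y h1
    exact extDeriv_extDeriv_apply (r := ω) h1.contDiffAt (by simp)

theorem dGerm_pullGerm [CompleteSpace W] {F : V → W} {x : V} {y : W} (hF : AnalyticAt ℂ F x) (hxy : F x = y)
    {r : ℕ} (γ : HolGerm y r) :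
    dGerm x r (pullGerm F hF hxy r γ) = pullGerm F hF hxy (r + 1) (dGerm y r γ) := by
  subst hxy
  induction γ using HolGerm.induction with
  | h η hη =>
    rw [pullGerm_mk, dGerm_mk, dGerm_mk, pullGerm_mk]
    refine HolGerm.mk_eq.2 ?_
    filter_upwards [hF.eventually_analyticAt, (hF.continuousAt.eventually hη.eventually_analyticAt)]
      with z h1 h2
    exact extDeriv_pullback (r := ω) h2.differentiableAt h1.contDiffAt (by simp)

theorem pullGerm_pullGerm [CompleteSpace W] [CompleteSpace U] {F : V → W} {G : W → U} {x : V} {y : W} {u : U}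
    (hF : AnalyticAt ℂ F x) (hxy : F x = y) (hG : AnalyticAt ℂ G y) (hyu : G y = u)
    {H : V → U} (hH : AnalyticAt ℂ H x) (hxu : H x = u) (hGF : H =ᶠ[𝓝 x] G ∘ F)
    {r : ℕ} (γ : HolGerm u r) :
    pullGerm F hF hxy r (pullGerm G hG hyu r γ) = pullGerm H hH hxu r γ := by
  obtain ⟨_, η, hη, rfl⟩ := γ
  subst hxy
  rw [Subtype.ext_iff]
  refine Germ.coe_eq.2 ?_
  filter_upwards [hGF.eventuallyEq_nhds, hF.eventually_analyticAt,
    (hF.continuousAt.eventually hG.eventually_analyticAt)] with z h1 h2 h3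
  have h4 : fderiv ℂ H z = (fderiv ℂ G (F z)).comp (fderiv ℂ F z) := by
    rw [h1.fderiv_eq, fderiv_comp _ h3.differentiableAt h2.differentiableAt]
  rw [h4, h1.eq_of_nhds]
  rfl

end Germs

section Faces

/-- The face maps `d_j : G^{s+1} → G^s`, `0 ≤ j ≤ s + 1`, of the simplicial manifold `BG`:
`d_0` drops `g_1`, `d_{s+1}` drops `g_{s+1}`, and `d_j` multiplies `g_j` and `g_{j+1}`
for `1 ≤ j ≤ s` (the entry `g_i` is `g (i - 1)` since `Fin` counts from `0`). -/
def face {G : Type*} [Group G] {s : ℕ} (j : Fin (s + 2)) (g : Fin (s + 1) → G) : Fin s → G :=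
  fun k =>
    if (k : ℕ) + 1 < j then g k.castSucc
    else if (k : ℕ) + 1 = j then g k.castSucc * g k.succ
    else g k.succ

theorem face_face {G : Type*} [Group G] {s : ℕ} (i : Fin (s + 2)) (j : Fin (s + 3))
    (h : (i : ℕ) < j) (g : Fin (s + 2) → G) :
    face i (face j g) = face (j.pred (by rintro rfl; simp at h)) (face i.castSucc g) := by
  funext k
  simp only [face, Fin.val_castSucc, Fin.val_succ, Fin.val_pred]
  split_ifs <;> first | omega | rfl | simp [mul_assoc]

theorem face_one {G : Type*} [Group G] {s : ℕ} (j : Fin (s + 2)) :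
    face j (fun _ => (1 : G)) = fun _ => 1 := by
  funext k
  simp [face]

theorem alternating_sum_eq_zero {A : Type*} [AddCommGroup A] {s : ℕ}
    (f : Fin (s + 2) → Fin (s + 3) → A)
    (hf : ∀ (i : Fin (s + 2)) (j : Fin (s + 3)) (h : (i : ℕ) < j),
      f i j = f (j.pred (by rintro rfl; simp at h)) i.castSucc) :
    ∑ i : Fin (s + 2), (-1 : ℤ) ^ (i : ℕ) • ∑ j : Fin (s + 3), (-1 : ℤ) ^ (j : ℕ) • f i j = 0 := by
  simp only [Finset.smul_sum, smul_smul]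
  rw [← Finset.sum_product']
  let P := Fin (s + 2) × Fin (s + 3)
  let S : Finset P := {ij : P | (ij.1 : ℕ) < (ij.2 : ℕ)}
  rw [Finset.univ_product_univ, ← Finset.sum_add_sum_compl S, ← eq_neg_iff_add_eq_zero,
    ← Finset.sum_neg_distrib]
  refine Finset.sum_bij (fun (ij : P) (h : ij ∈ S) =>
    ((ij.2.pred (by
      have h' : (ij.1 : ℕ) < (ij.2 : ℕ) := (Finset.mem_filter.1 h).2
      intro h0
      rw [h0] at h'
      simp at h'), ij.1.castSucc) : P)) ?_ ?_ ?_ ?_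
  · rintro ⟨i, j⟩ h
    have h' : (i : ℕ) < (j : ℕ) := (Finset.mem_filter.1 h).2
    simp only [S, Finset.compl_filter, Finset.mem_filter_univ, Fin.val_pred, Fin.val_castSucc]
    omega
  · rintro ⟨i, j⟩ h ⟨i', j'⟩ h' hh
    have h1 : (i : ℕ) < (j : ℕ) := (Finset.mem_filter.1 h).2
    have h2 : (i' : ℕ) < (j' : ℕ) := (Finset.mem_filter.1 h').2
    have e1 : (j : ℕ) - 1 = j' - 1 := congrArg (fun t : P => (t.1 : ℕ)) hh
    have e2 : (i : ℕ) = i' := congrArg (fun t : P => (t.2 : ℕ)) hh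
    exact Prod.ext (Fin.ext e2) (Fin.ext (show (j : ℕ) = j' by omega))
  · rintro ⟨i, j⟩ h
    simp only [S, Finset.compl_filter, Finset.mem_filter_univ] at h
    refine ⟨(j.castLT (by omega), i.succ), ?_, ?_⟩
    · simp only [S, Finset.mem_filter_univ, Fin.val_succ, Fin.val_castLT]
      omega
    · simp
  · rintro ⟨i, j⟩ h
    have h1 : (i : ℕ) < (j : ℕ) := (Finset.mem_filter.1 h).2
    dsimp only
    rw [hf i j h1, ← neg_smul]
    congr 1
    obtain ⟨k, hk⟩ : ∃ k, (j : ℕ) = k + 1 := ⟨j - 1, by omega⟩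
    simp only [Fin.val_castSucc, Fin.val_pred, hk, pow_succ, Nat.add_sub_cancel]
    ring

end Faces

section Coordinates

variable (E : Type*) [NormedAddCommGroup E] (G : Type*) [TopologicalSpace G] [ChartedSpace E G]
  [Group G]

/-- The coordinates of the point `(1, …, 1)` of `G^s` in the product chart. -/
noncomputable def basePt (s : ℕ) : Fin s → E := fun _ => chartAt E (1 : G) 1

variable {G}

/-- A map `G^m → G^n`, written in the `m`-fold and `n`-fold products of the chart of `G` at `1`. -/
noncomputable def inCoords {m n : ℕ} (f : (Fin m → G) → Fin n → G) (y : Fin m → E) : Fin n → E :=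
  fun i => chartAt E (1 : G) (f (fun k => (chartAt E (1 : G)).symm (y k)) i)

theorem chart_symm_basePt (s : ℕ) :
    (fun k => (chartAt E (1 : G)).symm (basePt E G s k)) = fun _ => 1 := by
  funext k
  exact (chartAt E (1 : G)).left_inv (mem_chart_source E 1)

theorem inCoords_basePt {m n : ℕ} {f : (Fin m → G) → Fin n → G}
    (h : f (fun _ => 1) = fun _ => 1) : inCoords E f (basePt E G m) = basePt E G n := by
  funext i
  simp only [inCoords, chart_symm_basePt, h]
  rfl

variable [NormedSpace ℂ E] [LieGroup 𝓘(ℂ, E) ω G]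

theorem contMDiffAt_face_symm {s : ℕ} (j : Fin (s + 2)) (i : Fin s) :
    ContMDiffAt 𝓘(ℂ, Fin (s + 1) → E) 𝓘(ℂ, E) ω
      (fun y : Fin (s + 1) → E => face j (fun k => (chartAt E (1 : G)).symm (y k)) i)
      (basePt E G (s + 1)) := by
  have hsymm : ContMDiffAt 𝓘(ℂ, E) 𝓘(ℂ, E) ω (chartAt E (1 : G)).symm (chartAt E (1 : G) 1) := by
    have := contMDiffOn_extChartAt_symm (I := 𝓘(ℂ, E)) (n := ω) (1 : G)
    simp only [mfld_simps] at this
    exact this.contMDiffAt ((chartAt E (1 : G)).open_target.mem_nhds (mem_chart_target E 1))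
  have hk : ∀ k : Fin (s + 1), ContMDiffAt 𝓘(ℂ, Fin (s + 1) → E) 𝓘(ℂ, E) ω
      (fun y : Fin (s + 1) → E => (chartAt E (1 : G)).symm (y k)) (basePt E G (s + 1)) := fun k =>
    ContMDiffAt.comp (g := (chartAt E (1 : G)).symm) (f := fun y : Fin (s + 1) → E => y k)
      (basePt E G (s + 1)) hsymm
      (contMDiffAt_iff_contDiffAt.2 (contDiff_apply ℂ E k).contDiffAt)
  simp only [face]
  split_ifs
  · exact hk _
  · exact (hk _).mul (hk _)
  · exact hk _

theorem analyticAt_inCoords_face {s : ℕ} (j : Fin (s + 2)) :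
    AnalyticAt ℂ (inCoords E (face (G := G) j)) (basePt E G (s + 1)) := by
  have hch : ContMDiffAt 𝓘(ℂ, E) 𝓘(ℂ, E) ω (chartAt E (1 : G)) 1 := by
    have := contMDiffAt_extChartAt (I := 𝓘(ℂ, E)) (n := ω) (x := (1 : G))
    simpa only [mfld_simps] using this
  refine AnalyticAt.pi fun i => ?_
  refine ContDiffAt.analyticAt (contMDiffAt_iff_contDiffAt.1 ?_)
  refine ContMDiffAt.comp (g := chartAt E (1 : G)) (basePt E G (s + 1)) (I' := 𝓘(ℂ, E)) ?_
    (contMDiffAt_face_symm E j i)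
  rw [chart_symm_basePt, face_one]
  exact hch

theorem inCoords_comp_face {s n : ℕ} (f : (Fin s → G) → Fin n → G) (j : Fin (s + 2)) :
    inCoords E (f ∘ face j) =ᶠ[𝓝 (basePt E G (s + 1))]
      inCoords E f ∘ inCoords E (face (G := G) j) := by
  have h : ∀ i : Fin s, ∀ᶠ y in 𝓝 (basePt E G (s + 1)),
      face j (fun k => (chartAt E (1 : G)).symm (y k)) i ∈ (chartAt E (1 : G)).source := fun i =>
    (contMDiffAt_face_symm E j i).continuousAt.eventually
      ((chartAt E (1 : G)).open_source.mem_nhds (by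
        beta_reduce
        rw [chart_symm_basePt, face_one]
        exact mem_chart_source E 1))
  filter_upwards [eventually_all.2 h] with y hy
  funext i
  have : (fun k => (chartAt E (1 : G)).symm (inCoords E (face (G := G) j) y k)) =
      face j (fun k => (chartAt E (1 : G)).symm (y k)) := by
    funext k
    exact (chartAt E (1 : G)).left_inv (hy k)
  simp only [inCoords, Function.comp_apply] at this ⊢
  rw [this]

variable (G) [CompleteSpace E]

/-- `Ω^r_loc(G^s)`: germs at `(1, …, 1)` of holomorphic `r`-forms on `G^s`, i.e. the direct limit of
`Ω^r(U)` over the open neighbourhoods `U` of `(1, …, 1)` in `G^s`. A form near `(1, …, 1)` is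
written in the product of the chart of `G` at `1`. -/
abbrev LocalForms (r s : ℕ) : Type _ := HolGerm (basePt E G s) r

/-- The pull-back `d_j^* : Ω^r_loc(G^s) → Ω^r_loc(G^{s+1})` along a face map. -/
noncomputable def coface (r s : ℕ) (j : Fin (s + 2)) :
    LocalForms E G r s →+ LocalForms E G r (s + 1) :=
  pullGerm (inCoords E (face (G := G) j)) (analyticAt_inCoords_face E j)
    (inCoords_basePt E (face_one j)) r

/-- The simplicial differential `∑_j (-1)^j d_j^*`. -/
noncomputable def simplicialD (r s : ℕ) : LocalForms E G r s →+ LocalForms E G r (s + 1) :=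
  ∑ j : Fin (s + 2), (-1 : ℤ) ^ (j : ℕ) • coface E G r s j

/-- The exterior derivative `Ω^r_loc(G^s) → Ω^{r+1}_loc(G^s)`. -/
noncomputable def deRhamD (r s : ℕ) : LocalForms E G r s →+ LocalForms E G (r + 1) s :=
  dGerm (basePt E G s) r

theorem simplicialD_apply {r s : ℕ} (γ : LocalForms E G r s) :
    simplicialD E G r s γ = ∑ j : Fin (s + 2), (-1 : ℤ) ^ (j : ℕ) • coface E G r s j γ := by
  simp [simplicialD]

theorem coface_coface {r s : ℕ} (i : Fin (s + 2)) (j : Fin (s + 3)) (h : (i : ℕ) < j)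
    (γ : LocalForms E G r s) :
    coface E G r (s + 1) j (coface E G r s i γ) =
      coface E G r (s + 1) i.castSucc
        (coface E G r s (j.pred (by rintro rfl; simp at h)) γ) := by
  have e : (face i ∘ face j : (Fin (s + 2) → G) → Fin s → G) =
      face (j.pred (by rintro rfl; simp at h)) ∘ face i.castSucc :=
    funext fun g => face_face i j h g
  have hE := inCoords_comp_face E (face (G := G) i) j
  have hE' := inCoords_comp_face E (face (G := G) (j.pred (by rintro rfl; simp at h))) i.castSucc
  rw [← e] at hE'
  have hA : AnalyticAt ℂ (inCoords E (face i ∘ face j : (Fin (s + 2) → G) → Fin s → G))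
      (basePt E G (s + 2)) := by
    refine AnalyticAt.congr ?_ hE.symm
    refine AnalyticAt.comp ?_ (analyticAt_inCoords_face E j)
    rw [inCoords_basePt E (face_one j)]
    exact analyticAt_inCoords_face E i
  have hB : inCoords E (face i ∘ face j : (Fin (s + 2) → G) → Fin s → G) (basePt E G (s + 2)) =
      basePt E G s := inCoords_basePt E (by simp [face_one])
  rw [coface, coface, coface, coface, pullGerm_pullGerm _ _ _ _ hA hB hE,
    pullGerm_pullGerm _ _ _ _ hA hB hE']

theorem simplicialD_simplicialD {r s : ℕ} (γ : LocalForms E G r s) :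
    simplicialD E G r (s + 1) (simplicialD E G r s γ) = 0 := by
  rw [simplicialD_apply E G γ, map_sum]
  simp only [map_zsmul, simplicialD_apply]
  exact alternating_sum_eq_zero _ fun i j h => coface_coface E G i j h γ

theorem deRhamD_simplicialD {r s : ℕ} (γ : LocalForms E G r s) :
    deRhamD E G r (s + 1) (simplicialD E G r s γ) =
      simplicialD E G (r + 1) s (deRhamD E G r s γ) := by
  simp only [simplicialD_apply, map_sum, map_zsmul]
  exact Finset.sum_congr rfl fun j _ => congrArg _ (dGerm_pullGerm _ _ γ)

end Coordinates

section DoubleComplexes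

universe u u'

/-- For an abelian group `A`: the subgroup `A` if `P` holds, and `0` otherwise. -/
def allOrZero (P : Prop) [Decidable P] (A : Type*) [AddCommGroup A] : AddSubgroup A :=
  if P then ⊤ else ⊥

/-- The identity of `A` if `P` holds, and the zero homomorphism otherwise. -/
def toAllOrZero (P : Prop) [Decidable P] (A : Type*) [AddCommGroup A] : A →+ allOrZero P A :=
  if h : P then (AddMonoidHom.id A).codRestrict _ fun x => by simp [allOrZero, h] else 0

theorem coe_toAllOrZero (P : Prop) [Decidable P] {A : Type*} [AddCommGroup A] (x : A) :
    (toAllOrZero P A x : A) = if P then x else 0 := by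
  unfold toAllOrZero
  split_ifs <;> simp

theorem eq_zero_of_not {P : Prop} [Decidable P] {A : Type*} [AddCommGroup A] (h : ¬ P)
    (x : allOrZero P A) : (x : A) = 0 := by
  have := x.2
  simpa [allOrZero, h] using this

/-- A first-quadrant double complex of abelian groups with commuting differentials `d` (in the
first index) and `δ` (in the second index). -/
structure DoubleComplex where
  X : ℕ → ℕ → Type u
  [addCommGroup : ∀ r s, AddCommGroup (X r s)]
  d : ∀ r s, X r s →+ X (r + 1) s
  δ : ∀ r s, X r s →+ X r (s + 1)
  d_d : ∀ r s x, d (r + 1) s (d r s x) = 0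
  δ_δ : ∀ r s x, δ r (s + 1) (δ r s x) = 0
  d_δ : ∀ r s x, d r (s + 1) (δ r s x) = δ (r + 1) s (d r s x)

attribute [instance] DoubleComplex.addCommGroup

namespace DoubleComplex

variable (C : DoubleComplex.{u}) (C' : DoubleComplex.{u'})

/-- The part `δ x^{r,s-1}` of the total differential, in bidegree `(r, s)`. -/
def totalδ (x : ∀ r s, C.X r s) : ∀ r s, C.X r s
  | _, 0 => 0
  | r, s + 1 => C.δ r s (x r s)

/-- The part `(-1)^s d x^{r-1,s}` of the total differential, in bidegree `(r, s)`. -/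
def totald (x : ∀ r s, C.X r s) : ∀ r s, C.X r s
  | 0, _ => 0
  | r + 1, s => (-1 : ℤ) ^ s • C.d r s (x r s)

/-- The total differential `D = δ + (-1)^s d`, acting on families of components. -/
def D : (∀ r s, C.X r s) →+ (∀ r s, C.X r s) where
  toFun x := fun r s => C.totalδ x r s + C.totald x r s
  map_zero' := by
    funext r s
    cases r <;> cases s <;> simp [totalδ, totald]
  map_add' x y := by
    funext r s
    cases r <;> cases s <;> simp [totalδ, totald]
    abel

/-- The degree `n` part `⨁_{r+s=n} X^{r,s}` of the total complex: the families of components that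
vanish in all bidegrees `(r, s)` with `r + s ≠ n`. -/
def cochains (n : ℕ) : AddSubgroup (∀ r s, C.X r s) where
  carrier := {x | ∀ r s, r + s ≠ n → x r s = 0}
  zero_mem' := fun _ _ _ => rfl
  add_mem' := fun {x y} hx hy r s h => by simp [hx r s h, hy r s h]
  neg_mem' := fun {x} hx r s h => by simp [hx r s h]

/-- The cocycles of degree `n` of the total complex. -/
def cocycles (n : ℕ) : AddSubgroup (∀ r s, C.X r s) := C.cochains n ⊓ C.D.ker

/-- The coboundaries of degree `n` of the total complex. -/
def coboundaries : ℕ → AddSubgroup (∀ r s, C.X r s)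
  | 0 => ⊥
  | n + 1 => (C.cochains n).map C.D

theorem D_D (x : ∀ r s, C.X r s) : C.D (C.D x) = 0 := by
  funext r s
  rcases r with _ | _ | r <;> rcases s with _ | _ | s <;>
    simp [D, totalδ, totald, C.d_d, C.δ_δ, C.d_δ, pow_succ]

theorem coboundaries_le_cocycles (n : ℕ) : C.coboundaries n ≤ C.cocycles n := by
  cases n with
  | zero => exact bot_le
  | succ n =>
    rintro _ ⟨x, hx, rfl⟩
    refine ⟨fun r s h => ?_, C.D_D x⟩
    have hx' : ∀ r s, r + s ≠ n → x r s = 0 := hx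
    rcases r with _ | r <;> rcases s with _ | s <;> simp only [D, totalδ, totald,
      AddMonoidHom.coe_mk, ZeroHom.coe_mk]
    · simp
    · rw [hx' 0 s (by omega)]; simp
    · rw [hx' r 0 (by omega)]; simp
    · rw [hx' (r + 1) s (by omega), hx' r (s + 1) (by omega)]; simp

/-- The degree `n` cohomology of the total complex of a double complex. -/
abbrev Cohomology (n : ℕ) : Type u :=
  C.cocycles n ⧸ (C.coboundaries n).addSubgroupOf (C.cocycles n)

variable {C C'}

/-- A morphism of double complexes. -/
structure Hom (C : DoubleComplex.{u}) (C' : DoubleComplex.{u'}) where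
  f : ∀ r s, C.X r s →+ C'.X r s
  f_d : ∀ r s x, f (r + 1) s (C.d r s x) = C'.d r s (f r s x)
  f_δ : ∀ r s x, f r (s + 1) (C.δ r s x) = C'.δ r s (f r s x)

/-- A morphism of double complexes, acting on families of components. -/
def Hom.total (φ : Hom C C') : (∀ r s, C.X r s) →+ (∀ r s, C'.X r s) where
  toFun x := fun r s => φ.f r s (x r s)
  map_zero' := by funext r s; simp
  map_add' x y := by funext r s; simp

theorem Hom.total_D (φ : Hom C C') (x : ∀ r s, C.X r s) :
    φ.total (C.D x) = C'.D (φ.total x) := by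
  funext r s
  rcases r with _ | r <;> rcases s with _ | s <;>
    simp [Hom.total, D, totalδ, totald, φ.f_d, φ.f_δ]

theorem Hom.total_mem_cochains (φ : Hom C C') {n : ℕ} {x : ∀ r s, C.X r s}
    (hx : x ∈ C.cochains n) : φ.total x ∈ C'.cochains n := fun r s h => by
  have : x r s = 0 := hx r s h
  simp [Hom.total, this]

theorem Hom.total_mem_cocycles (φ : Hom C C') {n : ℕ} {x : ∀ r s, C.X r s}
    (hx : x ∈ C.cocycles n) : φ.total x ∈ C'.cocycles n := by
  refine ⟨φ.total_mem_cochains hx.1, ?_⟩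
  have h : C.D x = 0 := hx.2
  change C'.D (φ.total x) = 0
  rw [← φ.total_D, h, map_zero]

theorem Hom.total_mem_coboundaries (φ : Hom C C') {n : ℕ} {x : ∀ r s, C.X r s}
    (hx : x ∈ C.coboundaries n) : φ.total x ∈ C'.coboundaries n := by
  cases n with
  | zero =>
    have : x = 0 := hx
    rw [this, map_zero]
    exact zero_mem _
  | succ n =>
    obtain ⟨y, hy, rfl⟩ := hx
    exact ⟨φ.total y, φ.total_mem_cochains hy, (φ.total_D y).symm⟩

/-- The homomorphism induced on the degree `n` cohomology of the total complexes by a morphism of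
double complexes. -/
def Hom.cohomologyMap (φ : Hom C C') (n : ℕ) : C.Cohomology n →+ C'.Cohomology n :=
  QuotientAddGroup.map _ _
    ((φ.total.comp (C.cocycles n).subtype).codRestrict (C'.cocycles n)
      fun x => φ.total_mem_cocycles x.2)
    fun _ hx => φ.total_mem_coboundaries hx


/-- The part of a double complex in the bidegrees `(r, s)` for which `P r` holds: the components with
`¬ P r` are replaced by `0`, and so are the differentials from or to such a component. For
`P r ↔ p ≤ r` this is the subcomplex `F^p`, for `P r ↔ r < p` the quotient by `F^p`. -/
def part (C : DoubleComplex.{u}) (P : ℕ → Prop) [DecidablePred P] : DoubleComplex.{u} where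
  X r s := allOrZero (P r) (C.X r s)
  d r s := (toAllOrZero (P (r + 1)) _).comp ((C.d r s).comp (AddSubgroup.subtype _))
  δ r s := (toAllOrZero (P r) _).comp ((C.δ r s).comp (AddSubgroup.subtype _))
  d_d r s x := by
    rw [Subtype.ext_iff]
    simp only [AddMonoidHom.comp_apply, AddSubgroup.subtype_apply, coe_toAllOrZero]
    split_ifs <;> simp [C.d_d]
  δ_δ r s x := by
    rw [Subtype.ext_iff]
    simp only [AddMonoidHom.comp_apply, AddSubgroup.subtype_apply, coe_toAllOrZero]
    split_ifs <;> simp [C.δ_δ]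
  d_δ r s x := by
    rw [Subtype.ext_iff]
    simp only [AddMonoidHom.comp_apply, AddSubgroup.subtype_apply, coe_toAllOrZero]
    by_cases h : P r
    · by_cases h' : P (r + 1) <;> simp [h, h', C.d_δ]
    · simp [h, eq_zero_of_not h x]

/-- The components of `DoubleComplex.cons`. -/
def consX (A : ℕ → Type u) (C : DoubleComplex.{u}) : ℕ → ℕ → Type u
  | 0, s => A s
  | q + 1, s => C.X q s

instance consAddCommGroup (A : ℕ → Type u) [∀ s, AddCommGroup (A s)] (C : DoubleComplex.{u}) :
    ∀ q s, AddCommGroup (consX A C q s)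
  | 0, s => inferInstanceAs (AddCommGroup (A s))
  | q + 1, s => inferInstanceAs (AddCommGroup (C.X q s))

/-- The double complex `A → C^{0,•} → C^{1,•} → ⋯` with `A` in first degree `0` and `C^{q,•}` in
first degree `q + 1`, for a complex `A` with a morphism `ε : A → C^{0,•}` such that `d ∘ ε = 0`. -/
def cons (A : ℕ → Type u) [∀ s, AddCommGroup (A s)] (C : DoubleComplex.{u})
    (δA : ∀ s, A s →+ A (s + 1)) (ε : ∀ s, A s →+ C.X 0 s)
    (δA_δA : ∀ s a, δA (s + 1) (δA s a) = 0) (ε_δA : ∀ s a, ε (s + 1) (δA s a) = C.δ 0 s (ε s a))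
    (d_ε : ∀ s a, C.d 0 s (ε s a) = 0) : DoubleComplex.{u} where
  X := consX A C
  d
    | 0, s => ε s
    | q + 1, s => C.d q s
  δ
    | 0, s => δA s
    | q + 1, s => C.δ q s
  d_d
    | 0, s, x => d_ε s x
    | q + 1, s, x => C.d_d q s x
  δ_δ
    | 0, s, x => δA_δA s x
    | q + 1, s, x => C.δ_δ q s x
  d_δ
    | 0, s, x => ε_δA s x
    | q + 1, s, x => C.d_δ q s x

/-- The morphism `[A → C^{0,•} → ⋯ → C^{p-1,•}] → F^p C` given by `d : C^{p-1,•} → C^{p,•}` in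
first degree `p ≥ 1` and by `0` in all other first degrees `q`. (For `q = 0` this is the first line
below; for `q = q' + 1 ≠ p` the source or the target in the second line is `0`.) -/
def consToPart (C : DoubleComplex.{u}) (p : ℕ) (A : ℕ → Type u) [∀ s, AddCommGroup (A s)]
    (δA : ∀ s, A s →+ A (s + 1)) (ε : ∀ s, A s →+ (C.part fun r => r < p).X 0 s)
    (δA_δA : ∀ s a, δA (s + 1) (δA s a) = 0)
    (ε_δA : ∀ s a, ε (s + 1) (δA s a) = (C.part fun r => r < p).δ 0 s (ε s a))
    (d_ε : ∀ s a, (C.part fun r => r < p).d 0 s (ε s a) = 0)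
    (h : ∀ s a, C.d 0 s (Subtype.val (p := (· ∈ allOrZero (0 < p) (C.X 0 s))) (ε s a)) = 0) :
    (cons A (C.part fun r => r < p) δA ε δA_δA ε_δA d_ε).Hom (C.part fun r => p ≤ r) where
  f
    | 0, _ => 0
    | q + 1, s => (toAllOrZero (p ≤ q + 1) (C.X (q + 1) s)).comp
        ((C.d q s).comp (AddSubgroup.subtype (allOrZero (q < p) (C.X q s))))
  f_d
    | 0, s, x => by
      refine Subtype.ext ((coe_toAllOrZero _ _).trans ?_)
      refine Eq.trans ?_ (congrArg Subtype.val (map_zero ((C.part fun r => p ≤ r).d 0 s))).symm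
      split_ifs
      · exact h s x
      · rfl
    | q + 1, s, x => by
      refine Subtype.ext ((coe_toAllOrZero _ _).trans (Eq.trans ?_ (coe_toAllOrZero _ _).symm))
      change (if p ≤ q + 2 then C.d (q + 1) s (toAllOrZero (q + 1 < p) _ (C.d q s x.1)) else 0) =
        (if p ≤ q + 2 then C.d (q + 1) s (toAllOrZero (p ≤ q + 1) _ (C.d q s x.1)) else 0)
      simp only [coe_toAllOrZero]
      split_ifs <;> simp [C.d_d]
  f_δ
    | 0, s, x => (map_zero ((C.part fun r => p ≤ r).δ 0 s)).symm
    | q + 1, s, x => by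
      refine Subtype.ext ((coe_toAllOrZero _ _).trans (Eq.trans ?_ (coe_toAllOrZero _ _).symm))
      change (if p ≤ q + 1 then C.d q (s + 1) (toAllOrZero (q < p) _ (C.δ q s x.1)) else 0) =
        (if p ≤ q + 1 then C.δ (q + 1) s (toAllOrZero (p ≤ q + 1) _ (C.d q s x.1)) else 0)
      have hx : ¬ q < p → x.1 = 0 := fun hq => eq_zero_of_not hq x
      simp only [coe_toAllOrZero]
      by_cases h1 : p ≤ q + 1
      · by_cases h2 : q < p
        · simp [h1, h2, C.d_δ]
        · simp [h1, h2, hx h2]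
      · simp [h1]

end DoubleComplex

variable (E : Type u) [NormedAddCommGroup E] [NormedSpace ℂ E] [CompleteSpace E]
  (G : Type u') [TopologicalSpace G] [ChartedSpace E G] [Group G] [LieGroup 𝓘(ℂ, E) ω G]

/-- The local de Rham double complex `Ω^•_loc(BG)`, with `(r, s)`-component `Ω^r_loc(G^s)`. -/
noncomputable def localDeRham : DoubleComplex.{u} where
  X r s := LocalForms E G r s
  d r s := deRhamD E G r s
  δ r s := simplicialD E G r s
  d_d _ _ x := dGerm_dGerm x
  δ_δ _ _ x := simplicialD_simplicialD E G x
  d_δ _ _ x := deRhamD_simplicialD E G x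

/-- The local truncated de Rham double complex `F^pΩ^•_loc(BG)`: its `(r, s)`-component is
`Ω^r_loc(G^s)` if `r ≥ p`, and `0` otherwise. -/
noncomputable def truncatedDeRham (p : ℕ) : DoubleComplex.{u} :=
  (localDeRham E G).part fun r => p ≤ r

/-- The germ at `(1, …, 1)` of a constant function on `G^s`. -/
noncomputable def constGerm (s : ℕ) : ℂ →+ LocalForms E G 0 s where
  toFun c := HolGerm.mk
    (fun _ => ContinuousAlternatingMap.constOfIsEmpty ℂ (Fin s → E) (Fin 0) c) analyticAt_const
  map_zero' := by
    rw [Subtype.ext_iff]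
    exact Germ.coe_eq.2 (Eventually.of_forall fun _ => by ext; simp)
  map_add' a b := by
    rw [Subtype.ext_iff]
    exact Germ.coe_eq.2 (Eventually.of_forall fun _ => by ext; simp)

theorem coface_constGerm {s : ℕ} (j : Fin (s + 2)) (c : ℂ) :
    coface E G 0 s j (constGerm E G s c) = constGerm E G (s + 1) c := by
  have h : ∀ {x : Fin (s + 1) → E} {y : Fin s → E} (F : (Fin (s + 1) → E) → Fin s → E)
      (hF : AnalyticAt ℂ F x) (hxy : F x = y),
      pullGerm F hF hxy 0 (HolGerm.mk
        (fun _ => ContinuousAlternatingMap.constOfIsEmpty ℂ (Fin s → E) (Fin 0) c)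
        analyticAt_const) =
      HolGerm.mk (fun _ => ContinuousAlternatingMap.constOfIsEmpty ℂ (Fin (s + 1) → E) (Fin 0) c)
        analyticAt_const := by
    intro x y F hF hxy
    subst hxy
    rw [pullGerm_mk]
    exact HolGerm.mk_eq.2 (Eventually.of_forall fun _ => by ext; simp)
  exact h _ _ _

theorem deRhamD_constGerm {s : ℕ} (c : ℂ) : deRhamD E G 0 s (constGerm E G s c) = 0 := by
  have h : HolGerm.mk (x := basePt E G s) (extDeriv (fun _ =>
      ContinuousAlternatingMap.constOfIsEmpty ℂ (Fin s → E) (Fin 0) c))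
      (analyticAt_extDeriv analyticAt_const) = HolGerm.mk (fun _ => 0) analyticAt_const :=
    HolGerm.mk_eq.2 (Eventually.of_forall fun y => by
      simp only [extDeriv, fderiv_fun_const, Pi.zero_apply]
      ext v
      simp [ContinuousAlternatingMap.alternatizeUncurryFin_apply])
  exact h

/-- The stalk at `(1, …, 1)` of the constant sheaf `ℤ(p) = (2πi)^p ℤ` on `G^s`, as a group of germs
of constant functions. -/
noncomputable def twistedIntegers (p s : ℕ) : AddSubgroup (LocalForms E G 0 s) :=
  (AddSubgroup.zmultiples ((2 * Real.pi * Complex.I : ℂ) ^ p)).map (constGerm E G s)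

theorem simplicialD_mem_twistedIntegers (p s : ℕ) (x : twistedIntegers E G p s) :
    simplicialD E G 0 s x ∈ twistedIntegers E G p (s + 1) := by
  obtain ⟨_, c, hc, rfl⟩ := x
  simp only [simplicialD_apply, coface_constGerm]
  exact sum_mem fun j _ => zsmul_mem (AddSubgroup.mem_map_of_mem (constGerm E G (s + 1)) hc) _

theorem deRhamD_twistedIntegers (p s : ℕ) (x : twistedIntegers E G p s) :
    deRhamD E G 0 s x = 0 := by
  obtain ⟨_, c, hc, rfl⟩ := x
  exact deRhamD_constGerm E G c

/-- The local Deligne double complex, whose total cohomology is `H^•_loc(BG, ℤ(p)_D)`. In bidegree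
`(q, s)` it is `ℤ(p)` for `q = 0`, the group `Ω^{q-1}_loc(G^s)` for `1 ≤ q ≤ p`, and `0` for
`q ≥ p + 1`. In the direction of `q` it is the germ `ℤ(p) → Ω^0 → ⋯ → Ω^{p-1}` of the Deligne
complex of sheaves on `G^s` (first the inclusion, then exterior derivatives), in the direction of `s`
the differential is the alternating sum of the pull-backs along the face maps. -/
noncomputable def localDeligne (p : ℕ) : DoubleComplex.{u} :=
  DoubleComplex.cons (fun s => twistedIntegers E G p s)
    ((localDeRham E G).part fun r => r < p)
    (fun s => ((simplicialD E G 0 s).comp (AddSubgroup.subtype _)).codRestrict _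
      (simplicialD_mem_twistedIntegers E G p s))
    (fun s => (toAllOrZero (0 < p) (LocalForms E G 0 s)).comp (AddSubgroup.subtype _))
    (fun s x => Subtype.ext (simplicialD_simplicialD E G _))
    (fun s x => by
      refine Subtype.ext ((coe_toAllOrZero _ _).trans (Eq.trans ?_ (coe_toAllOrZero _ _).symm))
      change (if 0 < p then simplicialD E G 0 s x.1 else 0) =
        if 0 < p then simplicialD E G 0 s (toAllOrZero (0 < p) _ x.1) else 0
      rw [coe_toAllOrZero]
      split_ifs <;> rfl)
    (fun s x => by
      refine Subtype.ext ((coe_toAllOrZero _ _).trans ?_)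
      change (if 0 + 1 < p then deRhamD E G 0 s (toAllOrZero (0 < p) _ x.1) else 0) = 0
      rw [coe_toAllOrZero]
      have := deRhamD_twistedIntegers E G p s x
      split_ifs <;> simp [this])

/-- The natural morphism `ℤ(p)_D → F^pΩ^•` between the local Deligne double complex and the local
truncated de Rham double complex of `BG`: in bidegrees `(p, s)`, `p ≥ 1`, it is the exterior
derivative `d : Ω^{p-1}_loc(G^s) → Ω^p_loc(G^s)`, and it is `0` in all other bidegrees. -/
noncomputable def deligneToDeRham (p : ℕ) :
    (localDeligne E G p).Hom (truncatedDeRham E G p) :=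
  DoubleComplex.consToPart (localDeRham E G) p _ _ _ _ _ _ fun s x => by
    change deRhamD E G 0 s (toAllOrZero (0 < p) _ x.1) = 0
    rw [coe_toAllOrZero]
    have := deRhamD_twistedIntegers E G p s x
    split_ifs <;> simp [this]

end DoubleComplexes

end LocalDeligne

/-! Continue the Deligne double complex past `q = p` to L : ℤ(p) → Ω^0 → Ω^1 → ⋯ (`consFull`). Then
L is an extension of the Deligne double complex by F^pΩ, shifted by one in the first degree. The
connecting homomorphism of this extension is, up to a global sign, the map induced by d : Ω^{p-1} →
Ω^p. Hence that map is bijective on H^n as soon as L has no cohomology in degrees n and n + 1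
(`consToPart_cohomologyMap_bijective`).

L is acyclic in all degrees ≥ 2 (`exists_D_cons_eq`). By the Poincaré lemma for germs the de Rham
rows resolve ℂ, so L has the cohomology of the two-step complex ℤ(p) → ℂ of constant simplicial
groups. On a constant group δ is an alternating sum of s + 2 identities: zero for even s, the
identity for odd s. Only s = 0 survives, which leaves ℂ/ℤ(p) in total degree 1. As 2p ≥ 2, the
criterion applies.

The Poincaré lemma (`exists_extDeriv_eq`) is proved by dividing Taylor coefficients instead of
integrating. The Lie derivative along the Euler field e = y - x multiplies the part of an (r+1)-form
with coefficients homogeneous of degree n by n + r + 1, so it is invertible on germs. Write a closed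
η as the Lie derivative of g. Then dg has Lie derivative dη = 0, so dg = 0, and Cartan's formula
gives η = d(ι_e g). -/

namespace LocalDeligne

/-! ### Inverting the shifted Euler operator on germs -/

section EulerOperator

variable {V F : Type*} [NormedAddCommGroup V] [NormedSpace ℂ V]
  [NormedAddCommGroup F] [NormedSpace ℂ F]

/-- The Euler vector field at `x` shifted by a positive integer is surjective on germs of analytic
functions: it multiplies the homogeneous part of degree `n` by `n + c`. -/
theorem exists_analyticAt_euler [CompleteSpace F] {f : V → F} {x : V} (hf : AnalyticAt ℂ f x)
    {c : ℕ} (hc : c ≠ 0) :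
    ∃ g : V → F, AnalyticAt ℂ g x ∧
      ∀ᶠ y in 𝓝 x, fderiv ℂ g y (y - x) + (c : ℂ) • g y = f y := by
  obtain ⟨p, ρ, hp⟩ := hf
  let q : FormalMultilinearSeries ℂ V F := fun n => ((n + c : ℕ) : ℂ)⁻¹ • p n
  have hnc : ∀ n : ℕ, ((n + c : ℕ) : ℂ) ≠ 0 := fun n => by
    exact_mod_cast (by omega : n + c ≠ 0)
  -- The factors 1/(n + c) have norm at most 1 because c ≥ 1, so the radius of convergence does not
  -- shrink.
  have hqp : p.radius ≤ q.radius := by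
    refine FormalMultilinearSeries.radius_le_of_le fun {n} => ?_
    have h1 : ‖((n + c : ℕ) : ℂ)⁻¹‖ ≤ 1 := by
      rw [norm_inv, Complex.norm_natCast]
      exact inv_le_one_of_one_le₀ (by exact_mod_cast (by omega : 1 ≤ n + c))
    calc ‖q n‖ = ‖((n + c : ℕ) : ℂ)⁻¹‖ * ‖p n‖ := norm_smul _ _
      _ ≤ 1 * ‖p n‖ := by gcongr
      _ = ‖p n‖ := one_mul _
  have hρ : 0 < q.radius := hp.r_pos.trans_le (hp.r_le.trans hqp)
  have hg : HasFPowerSeriesOnBall (fun y => q.sum (y - x)) q x q.radius := by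
    simpa using (q.hasFPowerSeriesOnBall hρ).comp_sub x
  refine ⟨_, hg.analyticAt, ?_⟩
  filter_upwards [Metric.eball_mem_nhds x hp.r_pos] with y hy
  have hy' : y ∈ Metric.eball x q.radius := Metric.eball_subset_eball (hp.r_le.trans hqp) hy
  have s1 := hg.hasSum_sub hy'
  have s2 := hg.fderiv.hasSum_sub hy'
  have s3 := hp.hasSum_sub hy
  have s4 : HasSum (fun n : ℕ => (n : ℂ) • q n fun _ => y - x)
      (fderiv ℂ (fun y => q.sum (y - x)) y (y - x)) := by
    -- The degree n term of the derivative series on the diagonal is (n + 1) • q (n + 1); the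
    -- missing term of index 0 is zero.
    rw [← hasSum_nat_add_iff' 1]
    have h := (ContinuousLinearMap.apply ℂ F (y - x)).hasSum s2
    simp only [ContinuousLinearMap.apply_apply,
      FormalMultilinearSeries.derivSeries_apply_diag, ← Nat.cast_smul_eq_nsmul ℂ] at h
    rw [Finset.sum_range_one, Nat.cast_zero, zero_smul, sub_zero]
    exact h
  refine (s4.add (s1.const_smul (c : ℂ))).unique ?_
  convert s3 using 2 with n
  rw [← add_smul]
  have : q n = ((n + c : ℕ) : ℂ)⁻¹ • p n := rfl
  rw [this, smul_apply, smul_smul, ← Nat.cast_add,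
    mul_inv_cancel₀ (hnc n), one_smul]

/-- The Euler vector field at `x` shifted by a positive integer is injective on germs of
differentiable functions. -/
theorem eventually_eq_zero_of_euler {h : V → F} {x : V} {c : ℕ} (hc : c ≠ 0)
    (hd : ∀ᶠ y in 𝓝 x, DifferentiableAt ℂ h y)
    (he : ∀ᶠ y in 𝓝 x, fderiv ℂ h y (y - x) + (c : ℂ) • h y = 0) : ∀ᶠ y in 𝓝 x, h y = 0 := by
  obtain ⟨ε, hε, hb⟩ := Metric.eventually_nhds_iff_ball.1 (hd.and he)
  filter_upwards [Metric.ball_mem_nhds x hε] with y hy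
  have hy0 : 0 < ε / (‖y - x‖ + 1) := by positivity
  have hmem : ∀ t : ℝ, t ∈ Set.Icc (0 : ℝ) 1 → x + (t : ℂ) • (y - x) ∈ Metric.ball x ε := by
    intro t ht
    rw [Metric.mem_ball, dist_eq_norm] at hy ⊢
    rw [add_sub_cancel_left, norm_smul, Complex.norm_real, Real.norm_of_nonneg ht.1]
    exact (mul_le_of_le_one_left (norm_nonneg _) ht.2).trans_lt hy
  -- Along the segment from x to y, the derivative of t^c h is t^(c-1) times the left-hand side of
  -- the Euler equation at x + t(y - x).
  have hder : ∀ t : ℝ, t ∈ Set.Icc (0 : ℝ) 1 →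
      HasDerivAt (fun t : ℝ => (t : ℂ) ^ c • h (x + (t : ℂ) • (y - x))) 0 t := by
    intro t ht
    have hbt := hb _ (hmem t ht)
    have h1 : HasDerivAt (fun z : ℂ => x + z • (y - x)) (y - x) (t : ℂ) := by
      simpa using ((hasDerivAt_id (t : ℂ)).smul_const (y - x)).const_add x
    have h2 := hbt.1.hasFDerivAt.comp_hasDerivAt (t : ℂ) h1
    have h3 := ((hasDerivAt_pow c (t : ℂ)).smul h2).scomp t Complex.ofRealCLM.hasDerivAt
    refine h3.congr_deriv ?_
    have h4 := hbt.2
    rw [add_sub_cancel_left, map_smul] at h4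
    obtain ⟨k, rfl⟩ := Nat.exists_eq_succ_of_ne_zero hc
    have h5 := congrArg (fun z => (t : ℂ) ^ k • z) h4
    simp only [smul_add, smul_smul, smul_zero] at h5
    rw [Complex.ofRealCLM_apply, Complex.ofReal_one, one_smul, ← h5]
    simp only [Nat.succ_eq_add_one, pow_succ, Nat.add_sub_cancel, Function.comp_apply]
    congr 2
    ring
  -- Compare t = 1, where the value is h y, with t = 0, where t^c vanishes because c ≠ 0.
  have hconst := constant_of_has_deriv_right_zero
    (fun t ht => (hder t ht).continuousAt.continuousWithinAt)
    (fun t ht => (hder t ⟨ht.1, ht.2.le⟩).hasDerivWithinAt) 1 (by simp)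
  simpa [hc] using hconst

theorem hasFDerivAt_clm_comp_apply_sub {H : Type*} [NormedAddCommGroup H] [NormedSpace ℂ H]
    (L : F →L[ℂ] V →L[ℂ] H) {g : V → F} {y : V} (x : V) (hg : DifferentiableAt ℂ g y) :
    HasFDerivAt (fun z => L (g z) (z - x))
      ((L.comp (fderiv ℂ g y)).flip (y - x) + L (g y)) y := by
  refine ((L.hasFDerivAt.comp y hg.hasFDerivAt).clm_apply
    ((hasFDerivAt_id y).sub_const x)).congr_fderiv ?_
  ext1 v
  exact add_comm _ _

theorem analyticAt_clm_comp_apply_sub {H : Type*} [NormedAddCommGroup H] [NormedSpace ℂ H]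
    [CompleteSpace F] [CompleteSpace H] (L : F →L[ℂ] V →L[ℂ] H) {g : V → F} {x : V}
    (hg : AnalyticAt ℂ g x) : AnalyticAt ℂ (fun z => L (g z) (z - x)) x :=
  ((L.contDiff.contDiffAt.comp x (hg.contDiffAt (n := ω))).clm_apply
    (contDiffAt_id.sub contDiffAt_const)).analyticAt

theorem fderiv_clm_comp {H : Type*} [NormedAddCommGroup H] [NormedSpace ℂ H]
    (L : F →L[ℂ] H) {g : V → F} {y : V} (hg : DifferentiableAt ℂ g y) :
    fderiv ℂ (fun z => L (g z)) y = L.comp (fderiv ℂ g y) :=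
  (L.hasFDerivAt.comp y hg.hasFDerivAt).fderiv

end EulerOperator

/-! ### Cartan's formula and the Poincaré lemma for germs -/

section PoincareLemma

variable {V : Type*} [NormedAddCommGroup V] [NormedSpace ℂ V]

open ContinuousAlternatingMap

/-- Currying of continuous alternating maps as a continuous linear map. -/
noncomputable def curryLeftCLM (V : Type*) [NormedAddCommGroup V] [NormedSpace ℂ V] (r : ℕ) :
    (V [⋀^Fin (r + 1)]→L[ℂ] ℂ) →L[ℂ] V →L[ℂ] V [⋀^Fin r]→L[ℂ] ℂ :=
  curryLeftLI.toContinuousLinearMap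

/-- This is the commutation of d with the Lie derivative along the Euler field. That derivative is
`fderiv ℂ g z (z - x)` plus r times g on r-forms, so passing to (r+1)-forms raises the shift by one,
which accounts for the extra summand. -/
theorem extDeriv_fderiv_apply_sub {r : ℕ} {g : V → V [⋀^Fin r]→L[ℂ] ℂ} {x y : V}
    (hg : ContDiffAt ℂ 2 g y) :
    extDeriv (fun z => fderiv ℂ g z (z - x)) y =
      fderiv ℂ (extDeriv g) y (y - x) + extDeriv g y := by
  have hd : DifferentiableAt ℂ (fderiv ℂ g) y :=
    (hg.fderiv_right (m := 1) (by norm_num)).differentiableAt one_ne_zero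
  have h1 : fderiv ℂ (fun z => fderiv ℂ g z (z - x)) y =
      fderiv ℂ (fderiv ℂ g) y (y - x) + fderiv ℂ g y := by
    refine (hd.hasFDerivAt.clm_apply ((hasFDerivAt_id y).sub_const x)).fderiv.trans ?_
    ext1 v
    -- Symmetry of the second derivative moves y - x into the slot of the outer derivative.
    have hs := (hg.isSymmSndFDerivAt (by simp)) v (y - x)
    simpa [add_comm] using hs
  have h2 : fderiv ℂ (extDeriv g) y =
      (alternatizeUncurryFinCLM ℂ V ℂ).comp (fderiv ℂ (fderiv ℂ g) y) :=
    fderiv_clm_comp (V := V) (F := V →L[ℂ] V [⋀^Fin r]→L[ℂ] ℂ) (H := V [⋀^Fin (r + 1)]→L[ℂ] ℂ)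
      (alternatizeUncurryFinCLM ℂ V ℂ) hd
  rw [h2, extDeriv, h1, alternatizeUncurryFin_add]
  rfl

/-- Cartan's formula for the Euler vector field at `x`. -/
theorem extDeriv_curryLeft_sub_add {r : ℕ} {g : V → V [⋀^Fin (r + 1)]→L[ℂ] ℂ} {x y : V}
    (hg : DifferentiableAt ℂ g y) :
    extDeriv (fun z => (g z).curryLeft (z - x)) y + (extDeriv g y).curryLeft (y - x) =
      fderiv ℂ g y (y - x) + ((r + 1 : ℕ) : ℂ) • g y := by
  have h1 : HasFDerivAt (fun z => (g z).curryLeft (z - x))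
      (((curryLeftCLM V r).comp (fderiv ℂ g y)).flip (y - x) + (g y).curryLeft) y :=
    hasFDerivAt_clm_comp_apply_sub (curryLeftCLM V r) x hg
  -- Differentiating the factor z - x contributes the alternatization of the curried form, which is
  -- the multiple (r + 1) • g y.
  rw [extDeriv, h1.fderiv, alternatizeUncurryFin_add, alternatizeUncurryFin_curryLeft]
  generalize y - x = w
  ext v
  have hr : ∀ i : Fin (r + 1), i.succ.removeNth (Matrix.vecCons w v) =
      Matrix.vecCons w (i.removeNth v) := fun i => by
    funext k
    refine Fin.cases ?_ (fun k => ?_) k <;> simp [Fin.removeNth]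
  have hc : ∀ (a : V [⋀^Fin (r + 1)]→L[ℂ] ℂ) (u : Fin r → V),
      curryLeftCLM V r a w u = a (Matrix.vecCons w u) := fun _ _ => rfl
  -- In the expansion of dg on (w, v) the index 0 gives the derivative along w. The other indices
  -- cancel against the part of d(ι g) that differentiates g.
  simp only [extDeriv, ContinuousAlternatingMap.add_apply, curryLeft_apply_apply,
    alternatizeUncurryFin_apply, Fin.sum_univ_succ (n := r + 1), Matrix.cons_val_succ, hr,
    Fin.val_succ, pow_succ, ContinuousLinearMap.flip_apply, ContinuousLinearMap.comp_apply, hc]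
  simp [Matrix.vecCons, Fin.removeNth_zero]
  ring

/-- The Poincaré lemma for germs of holomorphic forms of positive degree. -/
theorem exists_extDeriv_eq {r : ℕ} {η : V → V [⋀^Fin (r + 1)]→L[ℂ] ℂ} {x : V}
    (hη : AnalyticAt ℂ η x) (hd : ∀ᶠ y in 𝓝 x, extDeriv η y = 0) :
    ∃ θ : V → V [⋀^Fin r]→L[ℂ] ℂ, AnalyticAt ℂ θ x ∧ extDeriv θ =ᶠ[𝓝 x] η := by
  -- The shift is the degree r + 1 of η, so that g solves the equation "Lie derivative of g equals
  -- η".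
  obtain ⟨g, hg, hgη⟩ := exists_analyticAt_euler hη (Nat.succ_ne_zero r)
  have hdg := analyticAt_extDeriv hg
  have hclosed : ∀ᶠ y in 𝓝 x, extDeriv g y = 0 := by
    -- dg has degree r + 2, which is therefore the shift in the equation it satisfies; the
    -- right-hand side is dη = 0.
    refine eventually_eq_zero_of_euler (Nat.succ_ne_zero (r + 1))
      (hdg.eventually_analyticAt.mono fun y h => h.differentiableAt) ?_
    filter_upwards [hg.eventually_analyticAt, hgη.eventually_nhds, hd] with y h1 h2 h3
    have h4 : extDeriv (fun z => fderiv ℂ g z (z - x) + ((r + 1 : ℕ) : ℂ) • g z) y = 0 := by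
      rw [← h3]
      exact Filter.EventuallyEq.extDeriv_eq h2
    have h5 : DifferentiableAt ℂ (fun z => fderiv ℂ g z (z - x)) y :=
      h1.fderiv.differentiableAt.clm_apply (differentiableAt_id.sub_const x)
    rw [extDeriv_fun_add h5 (h1.differentiableAt.fun_const_smul _),
      show extDeriv (fun z => ((r + 1 : ℕ) : ℂ) • g z) y = ((r + 1 : ℕ) : ℂ) • extDeriv g y from
        extDeriv_fun_smul ((r + 1 : ℕ) : ℂ) g,
      extDeriv_fderiv_apply_sub h1.contDiffAt] at h4
    refine Eq.trans ?_ h4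
    have e : (((r + 1).succ : ℕ) : ℂ) = 1 + ((r + 1 : ℕ) : ℂ) := by push_cast; ring
    rw [add_assoc (fderiv ℂ (extDeriv g) y (y - x)), e, add_smul, one_smul]
  refine ⟨fun z => (g z).curryLeft (z - x), ?_, ?_⟩
  · exact analyticAt_clm_comp_apply_sub (curryLeftCLM V r) hg
  · filter_upwards [hclosed, hg.eventually_analyticAt, hgη] with y h1 h2 h3
    have := extDeriv_curryLeft_sub_add (x := x) h2.differentiableAt
    rw [h1, h3] at this
    simpa using this

/-- A germ of a function with zero exterior derivative is constant. -/
theorem eventually_eq_of_extDeriv_eq_zero {f : V → V [⋀^Fin 0]→L[ℂ] ℂ} {x : V}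
    (hf : AnalyticAt ℂ f x) (hd : ∀ᶠ y in 𝓝 x, extDeriv f y = 0) : ∀ᶠ y in 𝓝 x, f y = f x := by
  -- For 0-forms the alternatization has a single term, so d f = 0 says that the Fréchet derivative
  -- vanishes.
  have h0 : ∀ᶠ y in 𝓝 x, fderiv ℂ f y = 0 := by
    filter_upwards [hd] with y h
    ext v w
    have := congrArg (fun a => a (fun _ => v)) h
    simp only [extDeriv, alternatizeUncurryFin_apply] at this
    simpa [Subsingleton.elim w ((0 : Fin 1).removeNth fun _ => v)] using this
  obtain ⟨ε, hε, hb⟩ := Metric.eventually_nhds_iff_ball.1 (h0.and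
    hf.eventually_analyticAt)
  filter_upwards [Metric.ball_mem_nhds x hε] with y hy
  exact Metric.isOpen_ball.is_const_of_fderiv_eq_zero (convex_ball x ε).isPreconnected
    (fun z hz => (hb z hz).2.differentiableAt.differentiableWithinAt) (fun z hz => (hb z hz).1) hy
    (Metric.mem_ball_self hε)

theorem exists_dGerm_eq {x : V} {r : ℕ} (γ : HolGerm x (r + 1)) (h : dGerm x (r + 1) γ = 0) :
    ∃ θ, dGerm x r θ = γ := by
  induction γ using HolGerm.induction with
  | h η hη =>
    rw [dGerm_mk] at h
    obtain ⟨θ, hθ, he⟩ := exists_extDeriv_eq hη ((HolGerm.mk_eq (hθ := analyticAt_const)).1 h)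
    exact ⟨HolGerm.mk θ hθ, HolGerm.mk_eq (hη := analyticAt_extDeriv hθ).2 he⟩

theorem exists_const_of_dGerm_eq_zero {x : V} (γ : HolGerm x 0) (h : dGerm x 0 γ = 0) :
    ∃ c : ℂ, HolGerm.mk (fun _ => constOfIsEmpty ℂ V (Fin 0) c) analyticAt_const = γ := by
  induction γ using HolGerm.induction with
  | h η hη =>
    rw [dGerm_mk] at h
    refine ⟨η x 0, HolGerm.mk_eq (hη := analyticAt_const) |>.2 ?_⟩
    filter_upwards [eventually_eq_of_extDeriv_eq_zero hη
      ((HolGerm.mk_eq (hθ := analyticAt_const)).1 h)] with y hy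
    ext v
    simp [hy, Subsingleton.elim v 0]

end PoincareLemma

/-! ### Acyclicity of the augmented total complex in degrees ≥ 2 -/

section TotalComplex

universe u

namespace DoubleComplex

variable (C : DoubleComplex.{u})

theorem D_zero_zero (x : ∀ r s, C.X r s) : C.D x 0 0 = 0 := add_zero (0 : C.X 0 0)

theorem D_zero_succ (x : ∀ r s, C.X r s) (s : ℕ) : C.D x 0 (s + 1) = C.δ 0 s (x 0 s) :=
  add_zero (C.δ 0 s (x 0 s))

theorem D_succ_zero (x : ∀ r s, C.X r s) (r : ℕ) : C.D x (r + 1) 0 = C.d r 0 (x r 0) := by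
  simp [D, totalδ, totald]

theorem D_succ_succ (x : ∀ r s, C.X r s) (r s : ℕ) :
    C.D x (r + 1) (s + 1) =
      C.δ (r + 1) s (x (r + 1) s) + (-1 : ℤ) ^ (s + 1) • C.d r (s + 1) (x r (s + 1)) := rfl

theorem D_succ (x : ∀ r s, C.X r s) (r s : ℕ) :
    C.D x (r + 1) s = C.totalδ x (r + 1) s + (-1 : ℤ) ^ s • C.d r s (x r s) := rfl

/-- D raises the total degree by exactly one, so the degree n part of any primitive is a primitive.
This allows primitives to be built without tracking degrees. -/
theorem exists_mem_cochains_of_D_eq {n : ℕ} {x y : ∀ r s, C.X r s} (hx : x ∈ C.cochains (n + 1))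
    (h : C.D y = x) : ∃ z ∈ C.cochains n, C.D z = x := by
  classical
  refine ⟨fun r s => if r + s = n then y r s else 0, fun r s hrs => if_neg hrs, ?_⟩
  have hx' : ∀ r s, r + s ≠ n + 1 → x r s = 0 := hx
  subst h
  funext r s
  by_cases hrs : r + s = n + 1
  · rcases r with _ | r <;> rcases s with _ | s
    · omega
    · rw [D_zero_succ, D_zero_succ, if_pos (by omega)]
    · rw [D_succ_zero, D_succ_zero, if_pos (by omega)]
    · rw [D_succ_succ, D_succ_succ, if_pos (by omega), if_pos (by omega)]
  · rw [hx' r s hrs]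
    rcases r with _ | r <;> rcases s with _ | s
    · rw [D_zero_zero]
    · rw [D_zero_succ, if_neg (by omega), map_zero]
    · rw [D_succ_zero, if_neg (by omega), map_zero]
    · rw [D_succ_succ, if_neg (by omega), if_neg (by omega)]
      simp

/-- If the rows of a double complex are exact in first degrees `≥ 2`, then every cocycle is
cohomologous to one that vanishes in first degrees `≥ 2`. -/
theorem exists_D_eq_of_two_le
    (hexact : ∀ r s x, C.d (r + 2) s x = 0 → ∃ y, C.d (r + 1) s y = x)
    (x : ∀ r s, C.X r s) (hx : C.D x = 0) :
    ∃ y : ∀ r s, C.X r s, (∀ s, y 0 s = 0) ∧ ∀ r s, C.D y (r + 2) s = x (r + 2) s := by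
  choose! H hH using hexact
  let step : ∀ s, (∀ r, C.X r s) → ∀ r, C.X r s := fun s a r => match r, a with
    | 0, _ => 0
    | r + 1, a => (-1 : ℤ) ^ s • H r s (a (r + 2))
  -- Recursion on s, for all r at once: y at (r + 1, s) must satisfy (-1)^s d y = x - δ y in
  -- bidegree (r + 2, s), where δ y comes from (r + 2, s - 1). The chosen `H` is only meaningful on
  -- closed elements; closedness is checked in the induction below.
  let y' : ∀ s r, C.X r s := fun s => Nat.rec (motive := fun s => ∀ r, C.X r s)
    (step 0 fun r => x r 0) (fun s ys => step (s + 1) fun r => x r (s + 1) - C.δ r s (ys r)) s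
  let y : ∀ r s, C.X r s := fun r s => y' s r
  have hy0 : ∀ r, y (r + 1) 0 = (-1 : ℤ) ^ 0 • H r 0 (x (r + 2) 0) := fun r => rfl
  have hyS : ∀ r s, y (r + 1) (s + 1) =
      (-1 : ℤ) ^ (s + 1) • H r (s + 1) (x (r + 2) (s + 1) - C.δ (r + 2) s (y (r + 2) s)) :=
    fun r s => rfl
  refine ⟨y, fun s => by cases s <;> rfl, fun r s => ?_⟩
  have hsq : ∀ s : ℕ, (-1 : ℤ) ^ s * (-1) ^ s = 1 := fun s => by
    rw [← mul_pow]; simp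
  induction s generalizing r with
  | zero =>
    have h := congrFun (congrFun hx (r + 3)) 0
    rw [D_succ_zero] at h
    rw [D_succ_zero, hy0, pow_zero, one_smul, hH _ _ _ h]
  | succ s ih =>
    have h := congrFun (congrFun hx (r + 3)) (s + 1)
    have ih' := ih (r + 1)
    -- Combine the cocycle condition of x in bidegree (r + 3, s + 1) with δ applied to the induction
    -- hypothesis for r + 1, where δ² = 0 removes one term.
    have hd : C.d (r + 2) (s + 1) (x (r + 2) (s + 1) - C.δ (r + 2) s (y (r + 2) s)) = 0 := by
      rw [D_succ_succ] at h
      rw [D_succ] at ih'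
      have h2 : C.δ (r + 3) s (C.totalδ y (r + 3) s) = 0 := by
        cases s
        · exact map_zero _
        · exact C.δ_δ _ _ _
      have h3 : C.δ (r + 3) s (x (r + 3) s) =
          (-1 : ℤ) ^ s • C.δ (r + 3) s (C.d (r + 2) s (y (r + 2) s)) := by
        rw [← ih', map_add, map_zsmul, h2, zero_add]
      rw [map_sub, C.d_δ, sub_eq_zero]
      rw [h3, pow_succ, mul_neg_one, neg_smul, ← sub_eq_add_neg, ← smul_sub] at h
      have h4 := congrArg (fun z => (-1 : ℤ) ^ s • z) h
      simp only [smul_smul, hsq, one_smul] at h4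
      exact (sub_eq_zero.1 (h4.trans (smul_zero _))).symm
    rw [D_succ_succ, hyS, map_zsmul, smul_smul, hsq, one_smul, hH _ _ _ hd, add_sub_cancel]

/-- Acyclicity of the total complex of the augmented double complex `A → C^{0,•} → C^{1,•} → ⋯` in
degrees `≥ 2`, when the rows of `C` resolve a constant group `B`, and `A` is a constant subgroup of
`B`. -/
theorem exists_D_cons_eq {A : ℕ → Type u} [∀ s, AddCommGroup (A s)]
    {δA : ∀ s, A s →+ A (s + 1)} {ε : ∀ s, A s →+ C.X 0 s}
    {δA_δA : ∀ s a, δA (s + 1) (δA s a) = 0} {ε_δA : ∀ s a, ε (s + 1) (δA s a) = C.δ 0 s (ε s a)}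
    {d_ε : ∀ s a, C.d 0 s (ε s a) = 0}
    (hexact : ∀ r s x, C.d (r + 1) s x = 0 → ∃ y, C.d r s y = x)
    {B : Type*} [AddCommGroup B] (κ : ∀ s, B →+ C.X 0 s)
    (hκ : ∀ s x, C.d 0 s x = 0 → ∃ b, κ s b = x) (hκd : ∀ s b, C.d 0 s (κ s b) = 0)
    (hκi : ∀ s, Function.Injective (κ s))
    (hκe : ∀ s b, Even s → C.δ 0 s (κ s b) = 0)
    (hκo : ∀ s b, Odd s → C.δ 0 s (κ s b) = κ (s + 1) b)
    (hεi : ∀ s, Function.Injective (ε s))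
    (S : AddSubgroup B) (hε : ∀ s b, b ∈ S → ∃ a, ε s a = κ s b)
    (hεS : ∀ s a, ∃ b ∈ S, ε s a = κ s b)
    {n : ℕ} (hn : 2 ≤ n) {x : ∀ r s, (cons A C δA ε δA_δA ε_δA d_ε).X r s}
    (hx : x ∈ (cons A C δA ε δA_δA ε_δA d_ε).cocycles n) :
    x ∈ (cons A C δA ε δA_δA ε_δA d_ε).coboundaries n := by
  obtain ⟨n, rfl⟩ := Nat.exists_eq_succ_of_ne_zero (by omega : n ≠ 0)
  let L := cons A C δA ε δA_δA ε_δA d_ε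
  suffices h : ∃ y, L.D y = x from
    let ⟨_, hy⟩ := h
    L.exists_mem_cochains_of_D_eq hx.1 hy
  have hxD : L.D x = 0 := hx.2
  obtain ⟨y, hy0, hy⟩ := L.exists_D_eq_of_two_le (fun r s x h => hexact r s x h) x hxD
  suffices h : ∃ z, L.D z = x - L.D y from
    let ⟨z, hz⟩ := h
    ⟨z + y, by rw [map_add, hz, sub_add_cancel]⟩
  -- This is where n ≥ 2 is essential: a component in bidegree (1, 0), of total degree 1, could
  -- carry a nonzero class in B/S.
  have hw10 : (x - L.D y) 1 0 = 0 := by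
    have h1 : x 1 0 = 0 := hx.1 1 0 (by omega)
    rw [Pi.sub_apply, Pi.sub_apply, h1, D_succ_zero, hy0, map_zero, sub_zero]
  have hw2 : ∀ r s, (x - L.D y) (r + 2) s = 0 := fun r s => sub_eq_zero.2 (hy r s).symm
  have hwD : L.D (x - L.D y) = 0 := by rw [map_sub, hxD, L.D_D, sub_zero]
  generalize x - L.D y = w at hw10 hw2 hwD
  -- Now w lives in first degrees 0 and 1 only, so its components in first degree 1 are d-closed,
  -- hence constants c s.
  have hc : ∀ s, ∃ c, κ s c = w 1 s := fun s => hκ s _ <| by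
    have h := congrFun (congrFun hwD 2) s
    rw [D_succ] at h
    have h0 : L.totalδ w 2 s = 0 := by
      cases s with
      | zero => rfl
      | succ s => exact (congrArg (L.δ 2 s) (hw2 0 s)).trans (map_zero (L.δ 2 s))
    rw [h0, zero_add] at h
    have h4 := congrArg (fun z => (-1 : ℤ) ^ s • z) h
    simp only [smul_smul, ← mul_pow, mul_neg_one, neg_neg, one_pow, one_smul] at h4
    exact h4.trans (smul_zero _)
  choose c hc using hc
  have hw0 : ∀ s, C.δ 0 s (κ s (c s)) + (-1 : ℤ) ^ (s + 1) • ε (s + 1) (w 0 (s + 1)) = 0 :=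
    fun s => by
      rw [hc]
      exact congrFun (congrFun hwD 1) (s + 1)
  have hw0e : ∀ s, Even s → w 0 (s + 1) = 0 := fun s hs => hεi _ <| by
    have h := hw0 s
    rw [hκe _ _ hs, zero_add, hs.add_one.neg_one_pow, neg_one_smul, neg_eq_zero] at h
    exact h.trans (map_zero _).symm
  have hw0o : ∀ s, Odd s → ε (s + 1) (w 0 (s + 1)) = κ (s + 1) (-c s) := fun s hs => by
    have h := hw0 s
    rw [hκo _ _ hs, hs.add_one.neg_one_pow, one_smul] at h
    rw [map_neg]
    exact eq_neg_of_add_eq_zero_right h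
  have hw00 : w 0 0 = 0 := hεi _ <| by
    have h := congrFun (congrFun hwD 1) 0
    rw [D_succ_zero] at h
    exact h.trans (map_zero _).symm
  -- For odd s the cocycle condition identifies -c s with an element coming from A (s + 1), so it
  -- lies in S and also lifts to A s.
  have ha : ∀ s, ∃ a : A s, Odd s → ε s a = κ s (-c s) := fun s => by
    by_cases hs : Odd s
    · obtain ⟨b, hb, e⟩ := hεS _ (w 0 (s + 1))
      have hbc : b = -c s := hκi _ (e.symm.trans (hw0o s hs))
      obtain ⟨a, ha⟩ := hε s b hb
      exact ⟨a, fun _ => by rw [ha, hbc]⟩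
    · exact ⟨0, fun h => absurd h hs⟩
  choose a ha using ha
  classical
  -- In first degree 1, w is hit through ε from z 0 s when s is odd, and through δ = id from z 1 (s
  -- - 1) when s ≥ 2 is even. The case s = 0 is `hw10`.
  let z : ∀ r s, L.X r s := fun r s => match r with
    | 0 => if Odd s then a s else (0 : A s)
    | 1 => if Odd s then κ s (c (s + 1)) else (0 : C.X 0 s)
    | _ + 2 => 0
  have hz0o : ∀ s, Odd s → z 0 s = a s := fun s hs => if_pos hs
  have hz0e : ∀ s, Even s → z 0 s = 0 := fun s hs => if_neg (Nat.not_odd_iff_even.2 hs)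
  have hz1o : ∀ s, Odd s → z 1 s = κ s (c (s + 1)) := fun s hs => if_pos hs
  have hz1e : ∀ s, Even s → z 1 s = 0 := fun s hs => if_neg (Nat.not_odd_iff_even.2 hs)
  refine ⟨z, ?_⟩
  funext r s
  rcases r with _ | _ | r
  · rcases s with _ | s
    · rw [D_zero_zero, hw00]
    · rw [D_zero_succ]
      rcases Nat.even_or_odd s with hs | hs
      · rw [hz0e s hs, map_zero, hw0e s hs]
      · rw [hz0o s hs]
        refine hεi _ ((ε_δA s _).trans ?_)
        rw [ha s hs, hκo _ _ hs, hw0o s hs]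
  · rcases s with _ | s
    · rw [D_succ_zero, hz0e 0 (by simp), map_zero, hw10]
    · rw [D_succ_succ]
      rcases Nat.even_or_odd s with hs | hs
      · rw [hz1e s hs, map_zero]
        refine (zero_add _).trans ?_
        rw [hs.add_one.neg_one_pow, hz0o _ hs.add_one]
        have h1 : L.d 0 (s + 1) (a (s + 1)) = -w 1 (s + 1) :=
          (ha _ hs.add_one).trans ((map_neg _ _).trans (congrArg Neg.neg (hc _)))
        rw [h1, neg_one_smul, neg_neg]
      · rw [hz1o s hs, hz0e _ hs.add_one, map_zero, smul_zero, add_zero]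
        exact (hκo _ _ hs).trans (hc _)
  · rw [hw2]
    have h1 : ∀ s, L.d 1 s (z 1 s) = 0 := fun s => by
      rcases Nat.even_or_odd s with hs | hs
      · rw [hz1e s hs, map_zero]
      · rw [hz1o s hs]
        exact hκd _ _
    have h2 : L.d (r + 1) s (z (r + 1) s) = 0 := by
      rcases r with _ | r
      · exact h1 s
      · exact map_zero (L.d (r + 2) s)
    rw [D_succ, h2, smul_zero, add_zero]
    cases s with
    | zero => rfl
    | succ s => exact map_zero (L.δ (r + 2) s)

end DoubleComplex

end TotalComplex

/-! ### The truncation sequence and its connecting homomorphism -/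

section Truncation

universe u

namespace DoubleComplex

variable (C : DoubleComplex.{u}) (P : ℕ → Prop) [DecidablePred P]

/-- The inclusion of a component of `C.part P` into the corresponding component of `C`. -/
def partVal (r s : ℕ) : (C.part P).X r s →+ C.X r s :=
  AddSubgroup.subtype (allOrZero (P r) (C.X r s))

/-- The projection of a component of `C` to the corresponding component of `C.part P`. -/
def toPart (r s : ℕ) : C.X r s →+ (C.part P).X r s := toAllOrZero (P r) (C.X r s)

variable {C P}

theorem partVal_injective {r s : ℕ} : Function.Injective (C.partVal P r s) :=
  Subtype.val_injective

theorem partVal_toPart {r s : ℕ} (x : C.X r s) :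
    C.partVal P r s (C.toPart P r s x) = if P r then x else 0 := coe_toAllOrZero _ _

theorem partVal_d {r s : ℕ} (x : (C.part P).X r s) :
    C.partVal P (r + 1) s ((C.part P).d r s x) =
      if P (r + 1) then C.d r s (C.partVal P r s x) else 0 := coe_toAllOrZero _ _

theorem partVal_δ {r s : ℕ} (x : (C.part P).X r s) :
    C.partVal P r (s + 1) ((C.part P).δ r s x) =
      if P r then C.δ r s (C.partVal P r s x) else 0 := coe_toAllOrZero _ _

theorem part_eq_zero {r s : ℕ} (h : ¬ P r) (x : (C.part P).X r s) : x = 0 :=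
  partVal_injective (eq_zero_of_not h x)

theorem toPart_partVal {r s : ℕ} (x : (C.part P).X r s) :
    C.toPart P r s (C.partVal P r s x) = x := by
  refine partVal_injective ?_
  rw [partVal_toPart]
  split_ifs with h
  · rfl
  · rw [part_eq_zero h x, map_zero]

theorem toPart_d {r s : ℕ} (h : P (r + 1) → P r) (x : C.X r s) :
    C.toPart P (r + 1) s (C.d r s x) = (C.part P).d r s (C.toPart P r s x) := by
  refine partVal_injective ?_
  rw [partVal_toPart, partVal_d, partVal_toPart]
  split_ifs with h1 h2
  · rfl
  · exact absurd (h h1) h2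
  · rfl

theorem toPart_δ {r s : ℕ} (x : C.X r s) :
    C.toPart P r (s + 1) (C.δ r s x) = (C.part P).δ r s (C.toPart P r s x) := by
  refine partVal_injective ?_
  rw [partVal_toPart, partVal_δ, partVal_toPart]
  split_ifs <;> rfl

section Augmented

variable {p : ℕ} {A : ℕ → Type u} [∀ s, AddCommGroup (A s)]
    {δA : ∀ s, A s →+ A (s + 1)} {ε : ∀ s, A s →+ (C.part fun r => r < p).X 0 s}
    (δA_δA : ∀ s a, δA (s + 1) (δA s a) = 0)
    (ε_δA : ∀ s a, ε (s + 1) (δA s a) = (C.part fun r => r < p).δ 0 s (ε s a))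
    (d_ε : ∀ s a, (C.part fun r => r < p).d 0 s (ε s a) = 0)
    (h : ∀ s a, C.d 0 s (C.partVal (fun r => r < p) 0 s (ε s a)) = 0)

theorem partVal_ε_δA
    (ε_δA : ∀ s a, ε (s + 1) (δA s a) = (C.part fun r => r < p).δ 0 s (ε s a)) (s : ℕ) (a : A s) :
    C.partVal (fun r => r < p) 0 (s + 1) (ε (s + 1) (δA s a)) =
      C.δ 0 s (C.partVal (fun r => r < p) 0 s (ε s a)) := by
  rw [ε_δA, partVal_δ]
  split_ifs with hp
  · rfl
  · rw [part_eq_zero (P := fun r => r < p) hp (ε s a), map_zero, map_zero]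

/-- The double complex `A → C^{0,•} → C^{1,•} → ⋯`, for an augmentation `ε` of the truncation
of `C`. -/
abbrev consFull : DoubleComplex.{u} :=
  cons A C δA (fun s => (C.partVal (fun r => r < p) 0 s).comp (ε s)) δA_δA
    (partVal_ε_δA ε_δA) h

/-- The projection `[A → C^{0,•} → C^{1,•} → ⋯] → [A → C^{0,•} → ⋯ → C^{p-1,•}]`. -/
def consFullToCons :
    (consFull δA_δA ε_δA h).Hom (cons A (C.part fun r => r < p) δA ε δA_δA ε_δA d_ε) where
  f
    | 0, s => AddMonoidHom.id (A s)
    | q + 1, s => C.toPart (fun r => r < p) q s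
  f_d
    | 0, s, x => toPart_partVal (ε s x)
    | q + 1, s, x => toPart_d (P := fun r => r < p) (fun h => by omega) (r := q) x
  f_δ
    | 0, s, x => rfl
    | q + 1, s, x => toPart_δ (P := fun r => r < p) (r := q) x

/-- The components in first degrees `> p` of a family, as a family of components of `F^p C`. -/
def consFullTail : (∀ r s, (consFull δA_δA ε_δA h).X r s) →+
    (∀ r s, (C.part fun r => p ≤ r).X r s) where
  toFun y := fun r s => C.toPart (fun r => p ≤ r) r s (y (r + 1) s)
  map_zero' := by
    funext r s
    exact map_zero _
  map_add' x y := by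
    funext r s
    exact map_add (C.toPart (fun r => p ≤ r) r s) _ _

theorem consFullTail_mem_cochains {n : ℕ} {y : ∀ r s, (consFull δA_δA ε_δA h).X r s}
    (hy : y ∈ (consFull δA_δA ε_δA h).cochains (n + 1)) :
    consFullTail δA_δA ε_δA h y ∈ (C.part fun r => p ≤ r).cochains n := fun r s hrs =>
  (congrArg (C.toPart (fun r => p ≤ r) r s) (hy (r + 1) s (by omega))).trans (map_zero _)

/-- The tail fails to commute with D only by the differential that crosses the truncation, from
C^{p-1} to C^p; this identifies the connecting homomorphism. Shifting the first degree introduces no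
sign, since the sign in D depends on s alone. -/
theorem consFullTail_D (hp : 0 < p) (y : ∀ r s, (consFull δA_δA ε_δA h).X r s) (r s : ℕ) :
    consFullTail δA_δA ε_δA h ((consFull δA_δA ε_δA h).D y) r s =
      (C.part fun r => p ≤ r).D (consFullTail δA_δA ε_δA h y) r s + (-1 : ℤ) ^ s •
        (consToPart C p A δA ε δA_δA ε_δA d_ε h).total
          ((consFullToCons δA_δA ε_δA d_ε h).total y) r s := by
  by_cases hr : p ≤ r
  · obtain ⟨r, rfl⟩ : ∃ k, r = k + 1 := ⟨r - 1, by omega⟩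
    refine partVal_injective (C := C) (P := fun r => p ≤ r) ?_
    let z : ∀ r s, C.X r s := fun r s => y (r + 1) s
    have h1 : C.partVal (fun r => p ≤ r) (r + 1) s
        ((C.part fun r => p ≤ r).d r s (consFullTail δA_δA ε_δA h y r s)) =
        if p ≤ r then C.d r s (z r s) else 0 := by
      refine (partVal_d (C.toPart (fun r => p ≤ r) r s (z r s))).trans ?_
      rw [if_pos hr, partVal_toPart]
      split_ifs
      · rfl
      · exact map_zero _
    have h2 : C.partVal (fun r => p ≤ r) (r + 1) s
        ((consToPart C p A δA ε δA_δA ε_δA d_ε h).total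
          ((consFullToCons δA_δA ε_δA d_ε h).total y) (r + 1) s) =
        if p ≤ r then 0 else C.d r s (z r s) := by
      refine (partVal_toPart (P := fun r => p ≤ r) (C.d r s (C.partVal (fun r => r < p) r s
        (C.toPart (fun r => r < p) r s (z r s))))).trans ?_
      rw [if_pos hr, partVal_toPart]
      split_ifs with h3 h4
      · omega
      · rfl
      · exact map_zero _
      · omega
    have h3 : (consFull δA_δA ε_δA h).D y (r + 2) s =
        C.totalδ z (r + 1) s + (-1 : ℤ) ^ s • C.d r s (z r s) := by
      cases s <;> rfl
    have h4 : C.partVal (fun r => p ≤ r) (r + 1) s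
        (consFullTail δA_δA ε_δA h ((consFull δA_δA ε_δA h).D y) (r + 1) s) =
        C.totalδ z (r + 1) s + (-1 : ℤ) ^ s • C.d r s (z r s) :=
      (partVal_toPart _).trans ((if_pos hr).trans h3)
    have h5 : C.partVal (fun r => p ≤ r) (r + 1) s
        ((C.part fun r => p ≤ r).totalδ (consFullTail δA_δA ε_δA h y) (r + 1) s) =
        C.totalδ z (r + 1) s := by
      cases s with
      | zero => exact map_zero _
      | succ s =>
        refine (partVal_δ _).trans ((if_pos hr).trans ?_)
        exact congrArg (C.δ (r + 1) s) ((partVal_toPart (z (r + 1) s)).trans (if_pos hr))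
    -- The differential out of C^r is internal to F^p if p ≤ r, and is the crossing one if p = r +
    -- 1.
    have h6 : ((if p ≤ r then C.d r s (z r s) else 0) +
        if p ≤ r then 0 else C.d r s (z r s)) = C.d r s (z r s) := by
      split_ifs <;> simp
    rw [h4, D_succ, map_add, map_add, map_zsmul, map_zsmul, h1, h2, h5, add_assoc,
      ← smul_add, h6]
  · exact (part_eq_zero (P := fun r => p ≤ r) hr _).trans
      (part_eq_zero (P := fun r => p ≤ r) hr _).symm

/-- Together with `exists_consFull`: as graded groups, the full complex is the direct sum of its
truncation and its tail. -/
theorem consFull_eq_zero {y : ∀ r s, (consFull δA_δA ε_δA h).X r s}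
    (h1 : (consFullToCons δA_δA ε_δA d_ε h).total y = 0) (h2 : consFullTail δA_δA ε_δA h y = 0) :
    y = 0 := by
  funext r s
  rcases r with _ | r
  · exact congrFun (congrFun h1 0) s
  · by_cases hr : r < p
    · have := congrArg (C.partVal (fun r => r < p) r s) (congrFun (congrFun h1 (r + 1)) s)
      exact (((partVal_toPart (P := fun r => r < p) _).trans (if_pos hr)).symm.trans this).trans
        (map_zero _)
    · have := congrArg (C.partVal (fun r => p ≤ r) r s) (congrFun (congrFun h2 r) s)
      exact (((partVal_toPart (P := fun r => p ≤ r) _).trans (if_pos (not_lt.1 hr))).symm.trans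
        this).trans (map_zero _)

theorem exists_consFull
    {x : ∀ r s, (cons A (C.part fun r => r < p) δA ε δA_δA ε_δA d_ε).X r s}
    {w : ∀ r s, (C.part fun r => p ≤ r).X r s} {n : ℕ}
    (hx : x ∈ (cons A (C.part fun r => r < p) δA ε δA_δA ε_δA d_ε).cochains (n + 1))
    (hw : w ∈ (C.part fun r => p ≤ r).cochains n) :
    ∃ y ∈ (consFull δA_δA ε_δA h).cochains (n + 1),
      (consFullToCons δA_δA ε_δA d_ε h).total y = x ∧ consFullTail δA_δA ε_δA h y = w := by
  refine ⟨fun r s => match r with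
    | 0 => x 0 s
    | r + 1 => C.partVal (fun r => r < p) r s (x (r + 1) s) +
      C.partVal (fun r => p ≤ r) r s (w r s), ?_, ?_, ?_⟩
  · rintro (_ | r) s hrs
    · exact hx 0 s hrs
    · have h1 := congrArg (C.partVal (fun r => r < p) r s) (hx (r + 1) s hrs)
      have h2 := congrArg (C.partVal (fun r => p ≤ r) r s) (hw r s (by omega))
      exact (congrArg₂ (· + ·) (h1.trans (map_zero _)) (h2.trans (map_zero _))).trans (add_zero _)
  · funext r s
    rcases r with _ | r
    · rfl
    · by_cases hr : r < p
      · have h0 : C.partVal (fun r => p ≤ r) r s (w r s) = 0 := eq_zero_of_not (not_le.2 hr) _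
        refine (congrArg (fun z => C.toPart (fun r => r < p) r s
          (C.partVal (fun r => r < p) r s (x (r + 1) s) + z)) h0).trans ?_
        exact (congrArg (C.toPart (fun r => r < p) r s) (add_zero _)).trans
          (toPart_partVal (P := fun r => r < p) _)
      · exact (part_eq_zero (P := fun r => r < p) hr _).trans
          (part_eq_zero (P := fun r => r < p) hr _).symm
  · funext r s
    by_cases hr : p ≤ r
    · have h0 : C.partVal (fun r => r < p) r s (x (r + 1) s) = 0 :=
        eq_zero_of_not (not_lt.2 hr) _
      refine (congrArg (fun z => C.toPart (fun r => p ≤ r) r s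
        (z + C.partVal (fun r => p ≤ r) r s (w r s))) h0).trans ?_
      exact (congrArg (C.toPart (fun r => p ≤ r) r s) (zero_add _)).trans
          (toPart_partVal (P := fun r => p ≤ r) _)
    · exact (part_eq_zero (P := fun r => p ≤ r) hr _).trans
        (part_eq_zero (P := fun r => p ≤ r) hr _).symm

theorem consToPart_total_apply_eq_zero
    {x : ∀ r s, (cons A (C.part fun r => r < p) δA ε δA_δA ε_δA d_ε).X r s} {r s : ℕ}
    (hr : r ≠ p) : (consToPart C p A δA ε δA_δA ε_δA d_ε h).total x r s = 0 := by
  by_cases hpr : p ≤ r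
  · cases r with
    | zero => rfl
    | succ r =>
      refine partVal_injective (C := C) (P := fun r => p ≤ r) ?_
      refine (partVal_toPart (P := fun r => p ≤ r) (C.d r s (C.partVal (fun r => r < p) r s
        (x (r + 1) s)))).trans ?_
      rw [if_pos hpr, map_zero]
      have h0 : C.partVal (fun r => r < p) r s (x (r + 1) s) = 0 :=
        eq_zero_of_not (by omega : ¬ r < p) _
      rw [h0, map_zero]
  · exact part_eq_zero (P := fun r => p ≤ r) hpr _

/-- Only the bidegree (p, n - p) contributes in total degree n, so the sign (-1)^s is globally
(-1)^(n + p) and can be pulled out of the cohomology class. -/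
theorem zsmul_consToPart_total
    {x : ∀ r s, (cons A (C.part fun r => r < p) δA ε δA_δA ε_δA d_ε).X r s} {n : ℕ}
    (hx : x ∈ (cons A (C.part fun r => r < p) δA ε δA_δA ε_δA d_ε).cochains n) (r s : ℕ) :
    (-1 : ℤ) ^ s • (consToPart C p A δA ε δA_δA ε_δA d_ε h).total x r s =
      (-1 : ℤ) ^ (n + p) • (consToPart C p A δA ε δA_δA ε_δA d_ε h).total x r s := by
  by_cases hr : r = p
  · by_cases hs : r + s = n
    · subst hs hr
      have : (-1 : ℤ) ^ (r + s + r) = (-1) ^ s := by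
        rw [show r + s + r = s + 2 * r by ring, pow_add, pow_mul]
        simp
      rw [this]
    · rw [Hom.total_mem_cochains _ hx r s hs, smul_zero, smul_zero]
  · rw [consToPart_total_apply_eq_zero δA_δA ε_δA d_ε h hr, smul_zero, smul_zero]

/-- If `A → C^{0,•} → C^{1,•} → ⋯` is acyclic in total degrees `n` and `n + 1`, then `d` induces an
isomorphism from the cohomology of `A → C^{0,•} → ⋯ → C^{p-1,•}` to that of `F^p C` in degree `n`. -/
theorem consToPart_cohomologyMap_bijective (hp : 0 < p) {n : ℕ}
    (h1 : (consFull δA_δA ε_δA h).cocycles (n + 1) ≤ (consFull δA_δA ε_δA h).coboundaries (n + 1))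
    (h2 : (consFull δA_δA ε_δA h).cocycles (n + 2) ≤ (consFull δA_δA ε_δA h).coboundaries (n + 2)) :
    Function.Bijective
      ((consToPart C p A δA ε δA_δA ε_δA d_ε h).cohomologyMap (n + 1)) := by
  set φ := consToPart C p A δA ε δA_δA ε_δA d_ε h
  let π := consFullToCons δA_δA ε_δA d_ε h
  let ρ := consFullTail δA_δA ε_δA h
  let L := consFull δA_δA ε_δA h
  have hsq : ∀ k : ℕ, (-1 : ℤ) ^ k * (-1) ^ k = 1 := fun k => by
    rw [← mul_pow]; simp
  have hρD : ∀ {m : ℕ} {y}, y ∈ L.cochains m → ρ (L.D y) =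
      (C.part fun r => p ≤ r).D (ρ y) + (-1 : ℤ) ^ (m + p) • φ.total (π.total y) := by
    intro m y hy
    funext r s
    refine (consFullTail_D δA_δA ε_δA d_ε h hp y r s).trans ?_
    exact congrArg _
      (zsmul_consToPart_total δA_δA ε_δA d_ε h (π.total_mem_cochains hy) r s)
  constructor
  · refine (injective_iff_map_eq_zero _).2 fun ξ hξ => ?_
    obtain ⟨⟨x, hx⟩, rfl⟩ := QuotientAddGroup.mk_surjective ξ
    have hφx : φ.total x ∈ (C.part fun r => p ≤ r).coboundaries (n + 1) :=
      AddSubgroup.mem_addSubgroupOf.1 ((QuotientAddGroup.eq_zero_iff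
        (⟨φ.total x, φ.total_mem_cocycles hx⟩ : (C.part fun r => p ≤ r).cocycles (n + 1))).1 hξ)
    obtain ⟨w, hw, hwx⟩ := hφx
    -- Injectivity: if φ x = D w, glue x to a multiple of w whose sign makes the two terms of `hρD`
    -- cancel. The result is a cocycle y = D z, and projecting gives x = D (π z).
    obtain ⟨y, hy, hyx, hyw⟩ := exists_consFull δA_δA ε_δA d_ε h hx.1
      (zsmul_mem hw (-(-1 : ℤ) ^ (n + 1 + p)))
    have hyD : L.D y = 0 := by
      refine consFull_eq_zero δA_δA ε_δA d_ε h ?_ ?_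
      · rw [Hom.total_D, hyx]
        exact hx.2
      · refine (hρD hy).trans ?_
        rw [show ρ y = _ from hyw, show π.total y = x from hyx, map_zsmul, hwx, neg_smul,
          neg_add_cancel]
    obtain ⟨z, hz, hzy⟩ := h1 (show y ∈ L.cocycles (n + 1) from ⟨hy, hyD⟩)
    refine (QuotientAddGroup.eq_zero_iff _).2 (AddSubgroup.mem_addSubgroupOf.2 ?_)
    refine ⟨π.total z, π.total_mem_cochains hz, ?_⟩
    rw [← Hom.total_D, hzy]
    exact hyx
  · intro ξ
    obtain ⟨⟨w, hw⟩, rfl⟩ := QuotientAddGroup.mk_surjective ξ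
    -- Surjectivity: w extended by zero is a cocycle one degree higher, hence D z. The tail of D z =
    -- y reads w = D (ρ z) ± φ (π z), so ± π z is a preimage of the class of w.
    obtain ⟨y, hy, hyx, hyw⟩ := exists_consFull δA_δA ε_δA d_ε h (zero_mem _) hw.1
    have hyD : L.D y = 0 := by
      refine consFull_eq_zero δA_δA ε_δA d_ε h ?_ ?_
      · rw [Hom.total_D, hyx, map_zero]
      · refine (hρD hy).trans ?_
        rw [show ρ y = w from hyw, show π.total y = 0 from hyx, map_zero, smul_zero, add_zero]
        exact hw.2
    obtain ⟨z, hz, hzy⟩ := h2 (show y ∈ L.cocycles (n + 2) from ⟨hy, hyD⟩)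
    have hx : π.total z ∈
        (cons A (C.part fun r => r < p) δA ε δA_δA ε_δA d_ε).cocycles (n + 1) := by
      refine ⟨π.total_mem_cochains hz, ?_⟩
      change (cons A (C.part fun r => r < p) δA ε δA_δA ε_δA d_ε).D (π.total z) = 0
      rw [← Hom.total_D, hzy]
      exact hyx
    refine ⟨QuotientAddGroup.mk ⟨_, zsmul_mem hx ((-1 : ℤ) ^ (n + 1 + p))⟩,
      QuotientAddGroup.eq.2 (AddSubgroup.mem_addSubgroupOf.2 ?_)⟩
    refine ⟨ρ z, consFullTail_mem_cochains δA_δA ε_δA h hz, ?_⟩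
    have e := hρD hz
    rw [hzy, show ρ y = w from hyw] at e
    change _ = -φ.total ((-1 : ℤ) ^ (n + 1 + p) • π.total z) + w
    rw [e, map_zsmul, neg_add_eq_sub, add_sub_cancel_right]

end Augmented

end DoubleComplex

end Truncation

/-! ### Application to germs on BG -/

section LocalDeRham

universe u u'

theorem alternating_sum_const {B : Type*} [AddCommGroup B] (n : ℕ) (b : B) :
    ∑ j : Fin n, (-1 : ℤ) ^ (j : ℕ) • b = if Even n then 0 else b := by
  rw [← Finset.sum_smul, Fin.sum_univ_eq_sum_range (fun j => (-1 : ℤ) ^ j), neg_one_geom_sum]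
  split_ifs <;> simp

theorem constGerm_injective (E : Type*) [NormedAddCommGroup E] [NormedSpace ℂ E]
    (G : Type*) [TopologicalSpace G] [ChartedSpace E G] [Group G] (s : ℕ) :
    Function.Injective (constGerm E G s) := fun a b hab => by
  have h := (HolGerm.mk_eq (hη := analyticAt_const) (hθ := analyticAt_const)).1 hab
  exact congrArg (fun f => f 0) h.eq_of_nhds

variable (E : Type u) [NormedAddCommGroup E] [NormedSpace ℂ E] [CompleteSpace E]
  (G : Type u') [TopologicalSpace G] [ChartedSpace E G] [Group G] [LieGroup 𝓘(ℂ, E) ω G]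

/-- Each of the s + 2 cofaces preserves constants, so the coefficient is an alternating sum of s + 2
ones. -/
theorem simplicialD_constGerm (s : ℕ) (c : ℂ) :
    simplicialD E G 0 s (constGerm E G s c) = if Even s then 0 else constGerm E G (s + 1) c := by
  simp only [simplicialD_apply, coface_constGerm, alternating_sum_const, Nat.even_add, even_two,
    iff_true]

theorem deligneToDeRham_cohomologyMap_bijective {p n : ℕ} (hp : 0 < p) (hn : 2 ≤ n) :
    Function.Bijective ((deligneToDeRham E G p).cohomologyMap n) := by
  obtain ⟨n, rfl⟩ := Nat.exists_eq_succ_of_ne_zero (by omega : n ≠ 0)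
  -- Since p > 0 the truncation keeps Ω^0, and the augmentation is the plain inclusion of ℤ(p).
  have hε : ∀ s (a : twistedIntegers E G p s),
      (localDeRham E G).partVal (fun r => r < p) 0 s (toAllOrZero (0 < p) (LocalForms E G 0 s) a) =
        a.1 := fun s a => (coe_toAllOrZero _ _).trans (if_pos hp)
  refine DoubleComplex.consToPart_cohomologyMap_bijective _ _ _ _ hp ?_ ?_
  all_goals
    refine fun x hx => DoubleComplex.exists_D_cons_eq (localDeRham E G)
      (fun r s x h => exists_dGerm_eq x h) (constGerm E G)
      (fun s x h => exists_const_of_dGerm_eq_zero x h)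
      (fun s c => deRhamD_constGerm E G c) (constGerm_injective E G)
      (fun s c hs => (simplicialD_constGerm E G s c).trans (if_pos hs))
      (fun s c hs => (simplicialD_constGerm E G s c).trans (if_neg (Nat.not_even_iff_odd.2 hs)))
      (fun s a b hab => Subtype.ext ((hε s a).symm.trans (hab.trans (hε s b))))
      (AddSubgroup.zmultiples ((2 * Real.pi * Complex.I : ℂ) ^ p))
      (fun s c hc => ⟨⟨_, AddSubgroup.mem_map_of_mem _ hc⟩,
        hε s ⟨constGerm E G s c, AddSubgroup.mem_map_of_mem _ hc⟩⟩)
      (fun s a => ?_) (by omega) hx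
    obtain ⟨c, hc, e⟩ := a.2
    exact ⟨c, hc, (hε s a).trans e.symm⟩

end LocalDeRham

end LocalDeligne

theorem proposition4p1 {E : Type*} [NormedAddCommGroup E] [NormedSpace ℂ E] [CompleteSpace E]
    {G : Type*} [TopologicalSpace G] [ChartedSpace E G] [Group G] [LieGroup 𝓘(ℂ, E) ω G]
    (p : ℕ) (hp : 1 ≤ p) :
    ∃ e : (LocalDeligne.localDeligne E G p).Cohomology (2 * p) ≃+
        (LocalDeligne.truncatedDeRham E G p).Cohomology (2 * p),
      ∀ x, e x = (LocalDeligne.deligneToDeRham E G p).cohomologyMap (2 * p) x :=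
  ⟨AddEquiv.ofBijective _
    (LocalDeligne.deligneToDeRham_cohomologyMap_bijective E G hp (by omega)), fun _ => rfl⟩
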